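/- **Setting.** All manifolds are smooth, Hausdorff and second countable. Let $\alpha:P\to M$ be a smooth fiber bundle, $n=\dim M$, and let $VP=\ker d\alpha$. An affine $2$-form on $\alpha$ is a smooth $(n+1)$-form $\omega$ on $P$ such that $i_{Y_1}i_{Y_2}i_{Y_3}\omega=0$ for all vertical $Y_1,Y_2,Y_3$; it is identified with the affine map $\nabla\mapsto i_\nabla\omega$ on connections in $\alpha$, where, for a $1$-jet $c$ of sections of $\alpha$ at $y\in P$ with horizontal lift $h_c:T_{\alpha(y)}M\to T_yP$, $$ (i_c\omega_y)(\xi)(X_1,\dots,X_n)=\omega_y(\xi,h_cX_1,\dots,h_cX_n),\qquad \xi\in V_yP,\ X_i\in T_{\alpha(y)}M. $$ Its linear part $\underline\omega$ is the class of $\omega$ modulo the forms annihilated by the insertion of any two vertical vectors. For $\xi\in V_yP$, $i_\xi\underline\omega=0$ means that the $n$-form $i_\xi\omega_y$ vanishes whenever one of its arguments is vertical. Put $$D^\omega_y=\{\xi\in V_yP: i_\xi\omega_y=0\},\qquad \underline D^\omega_y=\{\xi\in V_yP: i_\xi\underline\omega_y=0\},$$ and let $\ker\omega$ (resp. $\ker\underline\omega$)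 be the module of smooth vertical vector fields $Y$ on $P$ with $i_Y\omega=0$ (resp. $i_Y\underline\omega=0$). A PD-prehamiltonian system on $\alpha$ is a closed affine $2$-form $\omega$; it is a PD-hamiltonian system if $\ker\underline\omega=0$. A smooth local section $\sigma:U\to P$ of $\alpha$, $U\subset M$ open, is a solution of the PD-Hamilton equations of $\omega$ if $i_{\dot\sigma}\omega|_\sigma=0$, i.e. $i_{\dot\sigma(x)}\omega_{\sigma(x)}=0$ for all $x\in U$, where the $1$-jet $\dot\sigma(x)$ has horizontal lift $d_x\sigma$. **Theorem (gauge reduction).** Let $\omega$ be a PD-prehamiltonian system on $\alpha$ with $\ker\omega=\ker\underline\omega$. Assume that the leaves of $D^\omega$ form a smooth fiber bundle $\widetilde\alpha:\widetilde P\to M$ in such a way that the canonical projection $\mathfrak p:P\to\widetilde P$ is a smooth fiber bundle; that is, $\widetilde\alpha\circ\mathfrak p=\alpha$, the fibers of $\mathfrak p$ are non-empty and connected, and $\ker d_y\mathfrak p=D^\omega_y$ for all $y\in P$. Then there is a unique PD-hamiltonian system $\widetilde\omega$ on $\widetilde\alpha$ such that $\omega=\mathfrak p^*\widetilde\omega$.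 Moreover: 1. $\ker\widetilde\omega=\ker\underline{\widetilde\omega}=0$; and if $\underline D^\omega$ has constant rank, then even $\underline D^{\widetilde\omega}_z=0$ for every $z\in\widetilde P$; 2. for every smooth local section $\sigma$ of $\alpha$, $\mathfrak p\circ\sigma$ is a smooth local section of $\widetilde\alpha$, and $\sigma$ is a solution of the PD-Hamilton equations of $\omega$ if and only if $\mathfrak p\circ\sigma$ is a solution of the PD-Hamilton equations of $\widetilde\omega$. -/

import Mathlib

open scoped Manifold ContDiff

universe u v

namespace PDHam

/-- A (not necessarily smooth) differential `k`-form on a `p`-dimensional manifold `P`. -/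
abbrev DForm (p k : ℕ) (P : Type u) [TopologicalSpace P]
    [ChartedSpace (EuclideanSpace ℝ (Fin p)) P] : Type u :=
  ∀ y : P, TangentSpace (𝓡 p) y [⋀^Fin k]→L[ℝ] ℝ

/-- A (not necessarily smooth) vector field on `P`. -/
abbrev VField (p : ℕ) (P : Type u) [TopologicalSpace P]
    [ChartedSpace (EuclideanSpace ℝ (Fin p)) P] : Type u :=
  ∀ y : P, TangentSpace (𝓡 p) y

section Forms

variable {p q k : ℕ}
  {P : Type u} [TopologicalSpace P] [ChartedSpace (EuclideanSpace ℝ (Fin p)) P]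
  {Q : Type v} [TopologicalSpace Q] [ChartedSpace (EuclideanSpace ℝ (Fin q)) Q]

/-- The pull-back `f^* Ω` of a differential form along a smooth map. -/
noncomputable def pullback (f : P → Q) (Ω : DForm q k Q) : DForm p k P := fun y =>
  (Ω (f y)).compContinuousLinearMap (mfderiv (𝓡 p) (𝓡 q) f y)

/-- The representative of a differential form in the preferred chart at `y₀`, i.e. its pull-back
along the inverse of that chart (meaningful on the target of the chart). -/
noncomputable def chartRep (Ω : DForm p k P) (y₀ : P) :
    EuclideanSpace ℝ (Fin p) → EuclideanSpace ℝ (Fin p) [⋀^Fin k]→L[ℝ] ℝ := fun u =>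
  (Ω ((extChartAt (𝓡 p) y₀).symm u)).compContinuousLinearMap
    (mfderiv (𝓡 p) (𝓡 p) (extChartAt (𝓡 p) y₀).symm u)

/-- Smooth differential forms. -/
def IsSmoothForm (Ω : DForm p k P) : Prop :=
  ∀ y₀ : P, ContDiffOn ℝ ∞ (chartRep Ω y₀) (extChartAt (𝓡 p) y₀).target

/-- The de Rham differential: at `y` it is computed in the chart at `y`. -/
noncomputable def deRham (Ω : DForm p k P) : DForm p (k + 1) P := fun y =>
  (extDeriv (chartRep Ω y) (extChartAt (𝓡 p) y y)).compContinuousLinearMap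
    (mfderiv (𝓡 p) (𝓡 p) (extChartAt (𝓡 p) y) y)

/-- The insertion `ξ ↦ i_ξ η = η(ξ, ⬝, …, ⬝)` of tangent vectors into a form `η` at a point. -/
noncomputable def interior {y : P} (η : TangentSpace (𝓡 p) y [⋀^Fin (k + 1)]→L[ℝ] ℝ) :
    TangentSpace (𝓡 p) y →ₗ[ℝ] (TangentSpace (𝓡 p) y [⋀^Fin k]→L[ℝ] ℝ) :=
  (ContinuousAlternatingMap.curryLeft (E := EuclideanSpace ℝ (Fin p)) η).toLinearMap

/-- Smooth vector fields. -/
def IsSmoothField [IsManifold (𝓡 p) ∞ P] (Y : VField p P) : Prop :=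
  ContMDiff (𝓡 p) (𝓡 p).tangent ∞ (fun y => (⟨y, Y y⟩ : TangentBundle (𝓡 p) P))

end Forms

/-- `π : Z → B` is a smooth fiber bundle: it is smooth, and around each point of the base there is
a local trivialization which is a diffeomorphism; the typical fiber is a smooth manifold. -/
def IsSmoothFiberBundle (b z : ℕ) {B : Type u} [TopologicalSpace B]
    [ChartedSpace (EuclideanSpace ℝ (Fin b)) B] {Z : Type v} [TopologicalSpace Z]
    [ChartedSpace (EuclideanSpace ℝ (Fin z)) Z] (π : Z → B) : Prop :=
  ContMDiff (𝓡 z) (𝓡 b) ∞ π ∧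
  ∀ x : B, ∃ (f : ℕ) (F : Type v) (_ : TopologicalSpace F)
    (_ : ChartedSpace (EuclideanSpace ℝ (Fin f)) F) (_ : IsManifold (𝓡 f) ∞ F)
    (e : Bundle.Trivialization F π), x ∈ e.baseSet ∧
      ContMDiffOn (𝓡 z) ((𝓡 b).prod (𝓡 f)) ∞ e e.source ∧
      ContMDiffOn ((𝓡 b).prod (𝓡 f)) (𝓡 z) ∞ e.toOpenPartialHomeomorph.symm e.target

section PD

variable {n p k : ℕ}
  {M : Type u} [TopologicalSpace M] [ChartedSpace (EuclideanSpace ℝ (Fin n)) M]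
  {P : Type v} [TopologicalSpace P] [ChartedSpace (EuclideanSpace ℝ (Fin p)) P]

variable (n) in
/-- The vertical tangent space `V_y P` of `α : P → M`. -/
noncomputable def vertical (α : P → M) (y : P) : Submodule ℝ (TangentSpace (𝓡 p) y) :=
  LinearMap.ker (mfderiv (𝓡 p) (𝓡 n) α y).toLinearMap

variable (n k) in
/-- The `k`-forms at `y` that vanish as soon as more than `r` of their arguments are vertical,
that is, the fiber at `y` of `Λ_{k-r}^k(P, α)`, where `Λ_p` is the `p`-th power of the ideal of
forms vanishing on the fibers of `α`. -/
noncomputable def verticalFiltration (α : P → M) (y : P) (r : ℕ) :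
    Submodule ℝ (TangentSpace (𝓡 p) y [⋀^Fin k]→L[ℝ] ℝ) where
  carrier := {η | ∀ (v : Fin k → TangentSpace (𝓡 p) y) (s : Finset (Fin k)), r < s.card →
    (∀ i ∈ s, v i ∈ vertical n α y) → η v = 0}
  add_mem' := fun {a b} ha hb v s hs hv => by
    rw [ContinuousAlternatingMap.add_apply, ha v s hs hv, hb v s hs hv, add_zero]
  zero_mem' := fun v s hs hv => rfl
  smul_mem' := fun c a ha v s hs hv => by
    rw [ContinuousAlternatingMap.smul_apply, ha v s hs hv, smul_zero]

/-- PD-prehamiltonian systems on `α : P → M`, `n = dim M`: closed affine 2-forms,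
that is, closed elements `Ω` of the module `Λ_{n-1}^{n+1}(P, α)` of smooth
`(n+1)`-forms annihilated by the insertion of any three vertical vectors. Such a form is identified,
as usual, with the affine map `∇ ↦ i_∇ Ω` on connections (see `insertJet`); closedness, insertions
and pull-backs of affine forms are those of the differential form. -/
def IsPDPrehamiltonian (α : P → M) (Ω : DForm p (n + 1) P) : Prop :=
  IsSmoothForm Ω ∧ (∀ y, Ω y ∈ verticalFiltration n (n + 1) α y 2) ∧ ∀ y, deRham Ω y = 0

/-- The distribution `D^Ω`: vertical `ξ` with `i_ξ Ω = 0`. -/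
noncomputable def dist (α : P → M) (Ω : DForm p (n + 1) P) (y : P) :
    Submodule ℝ (TangentSpace (𝓡 p) y) :=
  vertical n α y ⊓ LinearMap.ker (interior (Ω y))

/-- The distribution of vertical `ξ` with `i_ξ Ω̲ = 0`, where `Ω̲` is the linear part of the affine
form `Ω`, i.e. its class modulo `Λ_n`. Since `i_ξ Ω̲` is the class of the `n`-form `i_ξ Ω` modulo
`Λ_n`, the condition is that `i_ξ Ω` vanishes whenever one of its arguments is vertical. -/
noncomputable def linDist (α : P → M) (Ω : DForm p (n + 1) P) (y : P) :
    Submodule ℝ (TangentSpace (𝓡 p) y) :=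
  vertical n α y ⊓ (verticalFiltration n n α y 0).comap (interior (Ω y))

/-- `ker Ω`: the smooth vertical vector fields `Y` with `i_Y Ω = 0`. -/
def kerForm [IsManifold (𝓡 p) ∞ P] (α : P → M) (Ω : DForm p (n + 1) P) : Set (VField p P) :=
  {Y | IsSmoothField Y ∧ ∀ y, Y y ∈ dist α Ω y}

/-- `ker Ω̲`: the smooth vertical vector fields `Y` with `i_Y Ω̲ = 0`. -/
def kerLin [IsManifold (𝓡 p) ∞ P] (α : P → M) (Ω : DForm p (n + 1) P) : Set (VField p P) :=
  {Y | IsSmoothField Y ∧ ∀ y, Y y ∈ linDist α Ω y}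

/-- PD-hamiltonian systems: PD-prehamiltonian systems with `ker Ω̲ = 0`. -/
def IsPDHamiltonian [IsManifold (𝓡 p) ∞ P] (α : P → M) (Ω : DForm p (n + 1) P) : Prop :=
  IsPDPrehamiltonian α Ω ∧ kerLin α Ω = {0}

/-- The insertion `i_c Ω_y` of a 1-jet `c` at `y` into an affine 2-form. The jet is given by its
horizontal lift `h : T_x M → T_y P`, and `i_c Ω_y` is the component of `Ω_y` in
`V^*_y P ⊗ Λⁿ T^*_x M` with respect to the splitting of `T_y P` into the vertical space and the
range of `h`; it sends a vertical `ξ` to the form `(X₁, …, Xₙ) ↦ Ω(ξ, h X₁, …, h Xₙ)`. -/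
noncomputable def insertJet (α : P → M) {x : M} {y : P}
    (h : TangentSpace (𝓡 n) x →L[ℝ] TangentSpace (𝓡 p) y)
    (η : TangentSpace (𝓡 p) y [⋀^Fin (n + 1)]→L[ℝ] ℝ) :
    vertical (p := p) n α y → TangentSpace (𝓡 n) x [⋀^Fin n]→L[ℝ] ℝ := fun ξ =>
  (interior η (ξ : TangentSpace (𝓡 p) y)).compContinuousLinearMap h

variable (n p) in
/-- `σ` restricts to a smooth local section of `α` on the open set `U`
(its values outside `U` are irrelevant). -/
def IsLocalSection (α : P → M) (U : Set M) (σ : M → P) : Prop :=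
  IsOpen U ∧ ContMDiffOn (𝓡 n) (𝓡 p) ∞ σ U ∧ ∀ x ∈ U, α (σ x) = x

/-- The PD-Hamilton equations `i_{σ̇} Ω|_σ = 0` on `U`; the 1-jet `σ̇(x)` has horizontal lift
`d_x σ`. -/
def SolvesPDHamilton (α : P → M) (Ω : DForm p (n + 1) P) (U : Set M) (σ : M → P) : Prop :=
  ∀ x ∈ U, insertJet α (mfderiv (𝓡 n) (𝓡 p) σ x) (Ω (σ x)) = 0

end PD

/-- The fibers of the submersion `𝔭 : P → Q` are the leaves of the distribution `D` on `P`: each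
fiber is (nonempty and) connected, and its tangent space at each of its points `y` is `D y`. -/
def FibersAreLeaves {p : ℕ} (q : ℕ) {P : Type u} [TopologicalSpace P]
    [ChartedSpace (EuclideanSpace ℝ (Fin p)) P] {Q : Type v} [TopologicalSpace Q]
    [ChartedSpace (EuclideanSpace ℝ (Fin q)) Q] (𝔭 : P → Q)
    (D : ∀ y : P, Submodule ℝ (TangentSpace (𝓡 p) y)) : Prop :=
  (∀ z : Q, IsConnected (𝔭 ⁻¹' {z})) ∧ ∀ y : P, vertical q 𝔭 y = D y

end PDHam

/-! The form descends because it is constant along the fibers of `𝔭`. Vectors tangent to those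
fibers lie in `dist`, so they annihilate `Ω`. As `Ω` is also closed, Cartan's formula makes its
derivative along the fibers vanish. In a chart adapted to `𝔭` the coefficients are therefore locally
independent of the fiber coordinates (`BundleChart.flat_eq_of_fst_eq`), and connectedness of the
fibers turns this into a form on `Q` (`exists_eq_pullback`). Smoothness and closedness pass to `Q`
by pulling `Ω` back along local sections of `𝔭`. Uniqueness holds because `𝔭` and its derivatives
are surjective.

The kernels are compared through the fact that `linDist` of a pull-back is the full preimage, under
the derivative of `𝔭`, of `linDist` downstairs (`mem_linDist_pullback_iff`). A field in the linear
kernel on `Q` lifts locally to `P`. After a bump function cut-off it becomes a global field of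
`kerLin` with the right value at a chosen point (`IsSmoothFiberBundle.exists_lift`). By `kerForm =
kerLin` this lift is tangent to the fibers of `𝔭`, so the original field is zero.

In the constant rank case the same argument works vector by vector, since each vector of `linDist`
extends to a global field of `kerLin` (`exists_isSmoothField_linDist`).

For solutions, the PD-Hamilton expressions of `σ` and `𝔭 ∘ σ` agree once vertical vectors are pushed
forward, and every vertical vector on `Q` is such a push-forward. -/

namespace PDHam

/-! ### Calculus and linear algebra of alternating forms on normed spaces -/

section Calculus

variable {E F G : Type*} [NormedAddCommGroup E] [NormedSpace ℝ E]
  [NormedAddCommGroup F] [NormedSpace ℝ F] [NormedAddCommGroup G] [NormedSpace ℝ G] {k : ℕ}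

/-- The alternating forms are a complemented subspace of the multilinear forms. -/
theorem exists_leftInverse_toContinuousMultilinearMapCLM (E : Type*) [NormedAddCommGroup E]
    [NormedSpace ℝ E] (k : ℕ) :
    ∃ R : ContinuousMultilinearMap ℝ (fun _ : Fin k => E) ℝ →L[ℝ] E [⋀^Fin k]→L[ℝ] ℝ,
      ∀ g : E [⋀^Fin k]→L[ℝ] ℝ, R g.toContinuousMultilinearMap = g := by
  -- Antisymmetrization as a bounded operator, not yet normalized; on alternating maps it is
  -- multiplication by `k!`.
  let S : ContinuousMultilinearMap ℝ (fun _ : Fin k => E) ℝ →L[ℝ]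
      ContinuousMultilinearMap ℝ (fun _ : Fin k => E) ℝ :=
    ∑ σ : Equiv.Perm (Fin k), ((Equiv.Perm.sign σ : ℤ) : ℝ) •
      ((ContinuousMultilinearMap.domDomCongrₗᵢ ℝ E ℝ σ).toContinuousLinearEquiv :
        ContinuousMultilinearMap ℝ (fun _ : Fin k => E) ℝ →L[ℝ] _)
  have hS : ∀ f v, S f v = ContinuousMultilinearMap.alternatization f v := by
    intro f v
    simp only [S, ContinuousMultilinearMap.alternatization_apply_apply, sum_apply, smul_apply,
      Units.smul_def]
    refine Finset.sum_congr rfl fun σ _ => ?_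
    rw [zsmul_eq_mul, smul_eq_mul]
    rfl
  refine ⟨((k.factorial : ℝ)⁻¹) • ContinuousAlternatingMap.liftCLM S ?_, fun g => ?_⟩
  · intro f v i j hij hne
    rw [hS]
    exact (ContinuousMultilinearMap.alternatization f).map_eq_zero_of_eq v hij hne
  · ext v
    have h : ∀ σ : Equiv.Perm (Fin k), Equiv.Perm.sign σ • g (v ∘ σ) = g v := by
      intro σ
      have h' : g (v ∘ σ) = Equiv.Perm.sign σ • g v := g.toAlternatingMap.map_perm v σ
      rw [h', smul_smul, Int.units_mul_self, one_smul]
    have : ContinuousMultilinearMap.alternatization g.toContinuousMultilinearMap v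
        = (k.factorial : ℝ) * g v := by
      rw [ContinuousMultilinearMap.alternatization_apply_apply]
      simp only [ContinuousAlternatingMap.coe_toContinuousMultilinearMap, h]
      simp [Fintype.card_perm]
    rw [smul_apply, ContinuousAlternatingMap.smul_apply,
      ContinuousAlternatingMap.liftCLM_apply, hS, this, smul_eq_mul, ← mul_assoc,
      inv_mul_cancel₀ (by positivity), one_mul]

/-- For multilinear maps, composition is analytic jointly in the form and the linear maps. The
bounded retraction `R` brings the result back to alternating forms. -/
theorem ContDiffAt.compContinuousLinearMap_alternating {g : E → G [⋀^Fin k]→L[ℝ] ℝ}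
    {L : E → F →L[ℝ] G} {u : E} (hg : ContDiffAt ℝ ∞ g u) (hL : ContDiffAt ℝ ∞ L u) :
    ContDiffAt ℝ ∞ (fun v => (g v).compContinuousLinearMap (L v)) u := by
  obtain ⟨R, hR⟩ := exists_leftInverse_toContinuousMultilinearMapCLM F k
  have h1 : ContDiffAt ℝ ∞ (fun v => ((g v).toContinuousMultilinearMap.compContinuousLinearMap
      (fun _ : Fin k => L v))) u := by
    have h2 := (ContinuousMultilinearMap.analyticAt_uncurry_compContinuousLinearMap (𝕜 := ℝ)
      (q := ((fun _ : Fin k => L u), (g u).toContinuousMultilinearMap))).contDiffAt (n := ∞)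
    have h4 := (ContinuousAlternatingMap.toContinuousMultilinearMapCLM ℝ :
      (G [⋀^Fin k]→L[ℝ] ℝ) →L[ℝ] _).contDiff.contDiffAt.comp u hg
    exact h2.comp u ((contDiffAt_pi.2 fun _ : Fin k => hL).prodMk h4)
  have h5 := R.contDiff.contDiffAt.comp u h1
  refine h5.congr_of_eventuallyEq (Filter.Eventually.of_forall fun v => ?_)
  exact (hR ((g v).compContinuousLinearMap (L v))).symm

/-- A closed form annihilated by a fixed vector near `u` has zero derivative along it. -/
theorem fderiv_eq_zero_of_extDeriv_eq_zero {θ : E → E [⋀^Fin (k + 1)]→L[ℝ] ℝ} {u ξ : E}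
    (hθ : DifferentiableAt ℝ θ u) (hd : extDeriv θ u = 0)
    (hξ : ∀ᶠ u' in nhds u, ∀ v : Fin k → E, θ u' (Matrix.vecCons ξ v) = 0) :
    fderiv ℝ θ u ξ = 0 := by
  ext v
  have h := extDeriv_apply hθ (Matrix.vecCons ξ v)
  rw [hd, Fin.sum_univ_succ] at h
  -- In the expansion of `dθ(ξ, v)`, every term differentiating along some `v i` still has `ξ`
  -- inserted, so it differentiates a locally zero function. Only the derivative along `ξ` survives.
  have hz : ∀ i : Fin (k + 1), fderiv ℝ
      (fun u' => θ u' (i.succ.removeNth (Matrix.vecCons ξ v))) u = 0 := by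
    intro i
    have : (fun u' => θ u' (i.succ.removeNth (Matrix.vecCons ξ v))) =ᶠ[nhds u] fun _ => 0 := by
      filter_upwards [hξ] with u' hu'
      have : i.succ.removeNth (Matrix.vecCons ξ v) = Matrix.vecCons ξ (i.removeNth v) := by
        ext j
        refine Fin.cases ?_ (fun j => ?_) j
        · simp [Fin.removeNth]
        · simp [Fin.removeNth]
      rw [this, hu']
    rw [this.fderiv_eq]; simp
  simp only [hz] at h
  have h0 : (Fin.removeNth 0 (Matrix.vecCons ξ v) : Fin (k + 1) → E) = v := by
    ext j; simp [Fin.removeNth]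
  rw [h0] at h
  have h1 := fderiv_continuousAlternatingMap_apply_const_apply hθ v ξ
  simp at h
  rw [← h1, ← h]; rfl

/-- A vector in the kernel of one member of a smooth family of linear maps of constant rank extends
to a smooth family of vectors in the kernels. -/
theorem exists_contDiffOn_mem_ker [FiniteDimensional ℝ F] {A : E → F →L[ℝ] G}
    {T : Set E}
    (hT : IsOpen T) (hA : ContDiffOn ℝ ∞ A T) {u₀ : E} (hu₀ : u₀ ∈ T) {r : ℕ}
    (hr : ∀ u ∈ T, Module.finrank ℝ (LinearMap.ker (A u).toLinearMap) = r) {v₀ : F}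
    (hv₀ : A u₀ v₀ = 0) :
    ∃ T' ⊆ T, IsOpen T' ∧ u₀ ∈ T' ∧ ∃ v : E → F, ContDiffOn ℝ ∞ v T' ∧ v u₀ = v₀ ∧
      ∀ u ∈ T', A u (v u) = 0 := by
  -- Projecting to the range at `u₀` makes the map surjective there. `B u ∘L S` is then invertible
  -- near `u₀`, and subtracting `S (B u ∘L S)⁻¹ (B u v₀)` pushes `v₀` into the kernel of `B u`.
  let R : Submodule ℝ G := LinearMap.range (A u₀).toLinearMap
  obtain ⟨pr, hpr⟩ := Submodule.ClosedComplemented.of_finiteDimensional (𝕜 := ℝ) R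
  let B : E → F →L[ℝ] R := fun u => pr ∘L A u
  have hB : ContDiffOn ℝ ∞ B T := contDiffOn_const.clm_comp hA
  have hBs : Function.Surjective (B u₀) := by
    rintro ⟨_, x, rfl⟩
    exact ⟨x, hpr ⟨A u₀ x, ⟨x, rfl⟩⟩⟩
  obtain ⟨S', hS'⟩ := (B u₀).toLinearMap.exists_rightInverse_of_surjective
    (LinearMap.range_eq_top.2 hBs)
  let S : R →L[ℝ] F := LinearMap.toContinuousLinearMap S'
  have hS : B u₀ ∘L S = 1 := by
    ext1 x; exact LinearMap.congr_fun hS' x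
  have hBS : ContDiffOn ℝ ∞ (fun u => B u ∘L S) T := hB.clm_comp contDiffOn_const
  have : CompleteSpace R := FiniteDimensional.complete ℝ R
  have hopen : IsOpen {L : R →L[ℝ] R | IsUnit L} :=
    Units.isOpen (R := R →L[ℝ] R)
  refine ⟨T ∩ (fun u => B u ∘L S) ⁻¹' {L | IsUnit L}, Set.inter_subset_left,
    hBS.continuousOn.isOpen_inter_preimage hT hopen, ⟨hu₀, ?_⟩,
    fun u => v₀ - S (Ring.inverse (B u ∘L S) (B u v₀)), ?_, ?_, ?_⟩
  · simp [hS]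
  · refine contDiffOn_const.sub (contDiffOn_const.clm_apply (ContDiffOn.clm_apply ?_ ?_))
    · rintro u ⟨hu, hu'⟩
      obtain ⟨w, hw⟩ : IsUnit (B u ∘L S) := hu'
      have h1 := contDiffAt_ringInverse ℝ (R := R →L[ℝ] R) (n := ∞) w
      rw [hw] at h1
      exact (h1.comp_contDiffWithinAt u (hBS u hu)).mono Set.inter_subset_left
    · exact (hB.clm_apply contDiffOn_const).mono Set.inter_subset_left
  · have : B u₀ v₀ = 0 := by simp [B, hv₀]
    simp [this]
  · rintro u ⟨hu, hu'⟩
    have hu'' : IsUnit (B u ∘L S) := hu'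
    have hzero : B u (v₀ - S (Ring.inverse (B u ∘L S) (B u v₀))) = 0 := by
      rw [map_sub]
      have := congrArg (fun L : R →L[ℝ] R => L (B u v₀)) (Ring.mul_inverse_cancel _ hu'')
      simp only [mul_apply_eq_comp, ContinuousLinearMap.comp_apply,
        one_apply_eq_self] at this
      rw [this, sub_self]
    have hBu : Function.Surjective (B u) := by
      intro x
      have := congrArg (fun L : R →L[ℝ] R => L x) (Ring.mul_inverse_cancel _ hu'')
      exact ⟨_, this⟩
    have h1 := LinearMap.finrank_range_add_finrank_ker (A u₀).toLinearMap
    have h2 := LinearMap.finrank_range_add_finrank_ker (B u).toLinearMap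
    rw [LinearMap.range_eq_top.2 hBu, finrank_top] at h2
    have hle : LinearMap.ker (A u).toLinearMap ≤ LinearMap.ker (B u).toLinearMap := by
      intro x hx
      have hx' : A u x = 0 := hx
      change pr (A u x) = 0
      rw [hx', map_zero]
    -- Constant rank enters here: by rank-nullity and surjectivity of `B u`, its kernel has
    -- dimension `r`, so it is no larger than that of `A u`.
    have heq := Submodule.eq_of_le_of_finrank_eq hle (by
      have e1 := hr u hu
      have e2 := hr u₀ hu₀
      have e3 : Module.finrank ℝ (LinearMap.range (A u₀).toLinearMap) = Module.finrank ℝ R := rfl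
      omega)
    have : v₀ - S (Ring.inverse (B u ∘L S) (B u v₀)) ∈ LinearMap.ker (A u).toLinearMap := by
      rw [heq]; exact hzero
    exact this

/-- An alternating form factors through a surjection if it is annihilated by its kernel. -/
theorem alternating_apply_congr {η : E [⋀^Fin (k + 1)]→L[ℝ] ℝ} {K : Submodule ℝ E}
    (hK : ∀ ξ ∈ K, ∀ v : Fin k → E, η (Matrix.vecCons ξ v) = 0) {v w : Fin (k + 1) → E}
    (hvw : ∀ i, v i - w i ∈ K) : η v = η w := by
  have hzero : ∀ (i : Fin (k + 1)) (v : Fin (k + 1) → E), v i ∈ K → η v = 0 := by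
    intro i v hi
    have h1 : η (v ∘ Equiv.swap 0 i) = 0 := by
      have : v ∘ Equiv.swap 0 i = Matrix.vecCons (v i) (Fin.tail (v ∘ Equiv.swap 0 i)) := by
        ext j
        refine Fin.cases ?_ (fun j => ?_) j
        · simp
        · simp [Fin.tail]
      rw [this]; exact hK _ hi _
    have h2 : η (v ∘ Equiv.swap 0 i) = Equiv.Perm.sign (Equiv.swap 0 i) • η v :=
      η.toAlternatingMap.map_perm v _
    exact (smul_eq_zero_iff_eq _).1 (h2.symm.trans h1)
  -- Arguments are exchanged one at a time, each exchange costing a term with an entry in `K`.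
  have key : ∀ s : Finset (Fin (k + 1)), η (s.piecewise v w) = η w := by
    intro s
    induction s using Finset.induction_on with
    | empty => simp
    | insert i s hi ih =>
      rw [← ih, Finset.piecewise_insert]
      have h2 : s.piecewise v w = Function.update (s.piecewise v w) i (w i) := by
        rw [Function.eq_update_iff]; simp [hi]
      have h3 : Function.update (s.piecewise v w) i (v i)
          = Function.update (s.piecewise v w) i ((v i - w i) + w i) := by simp
      rw [h3, η.map_update_add, ← h2, hzero i _ (by simpa using hvw i), zero_add]
  simpa using key Finset.univ

end Calculus

/-- The model space. -/
abbrev Eu (d : ℕ) : Type := EuclideanSpace ℝ (Fin d)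

/-! ### Derivatives and pull-backs read in the model vector spaces -/

section Derivatives

variable {E₁ E₂ E₃ : Type*} [NormedAddCommGroup E₁] [NormedSpace ℝ E₁]
  [NormedAddCommGroup E₂] [NormedSpace ℝ E₂] [NormedAddCommGroup E₃] [NormedSpace ℝ E₃]
  {H₁ H₂ H₃ : Type*} [TopologicalSpace H₁] [TopologicalSpace H₂] [TopologicalSpace H₃]
  {I : ModelWithCorners ℝ E₁ H₁} {J : ModelWithCorners ℝ E₂ H₂} {K : ModelWithCorners ℝ E₃ H₃}
  {X Y Z : Type*} [TopologicalSpace X] [ChartedSpace H₁ X] [TopologicalSpace Y]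
  [ChartedSpace H₂ Y] [TopologicalSpace Z] [ChartedSpace H₃ Z]

variable (I J) in
/-- The derivative of a map between manifolds, as a map between the model vector spaces. -/
noncomputable def md (f : X → Y) (x : X) : E₁ →L[ℝ] E₂ := mfderiv I J f x

theorem md_congr {f g : X → Y} {x : X} (h : f =ᶠ[nhds x] g) : md I J f x = md I J g x :=
  h.mfderiv_eq

theorem md_comp {g : Y → Z} {f : X → Y} {x : X} (hg : MDifferentiableAt J K g (f x))
    (hf : MDifferentiableAt I J f x) : md I K (g ∘ f) x = md J K g (f x) ∘L md I J f x :=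
  mfderiv_comp x hg hf

theorem md_id {x : X} : md I I (fun x' : X => x') x = ContinuousLinearMap.id ℝ E₁ :=
  mfderiv_id

theorem md_vectorSpace {f : E₁ → E₂} {x : E₁} : md 𝓘(ℝ, E₁) 𝓘(ℝ, E₂) f x = fderiv ℝ f x :=
  mfderiv_eq_fderiv

end Derivatives

section Flat

variable {E : Type*} [NormedAddCommGroup E] [NormedSpace ℝ E] {H : Type*} [TopologicalSpace H]
  (I : ModelWithCorners ℝ E H) {X : Type*} [TopologicalSpace X] [ChartedSpace H X]
  {E' : Type*} [NormedAddCommGroup E'] [NormedSpace ℝ E'] {H' : Type*} [TopologicalSpace H']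
  (I' : ModelWithCorners ℝ E' H') {X' : Type*} [TopologicalSpace X'] [ChartedSpace H' X']
  {p k : ℕ} {P : Type*} [TopologicalSpace P] [ChartedSpace (Eu p) P]

/-- The value of a form as a form on the model vector space. -/
def DForm.at (Ω : DForm p k P) (y : P) : Eu p [⋀^Fin k]→L[ℝ] ℝ := Ω y

/-- The pull-back of a form on `P`, as a function with values in the forms on the model vector
space. -/
noncomputable def flat (f : X → P) (Ω : DForm p k P) (x : X) : E [⋀^Fin k]→L[ℝ] ℝ :=
  (Ω.at (f x)).compContinuousLinearMap (md I (𝓡 p) f x)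

variable {I I'}

theorem flat_congr {f g : X → P} {x : X} (h : f =ᶠ[nhds x] g) (Ω : DForm p k P) :
    flat I f Ω x = flat I g Ω x := by
  rw [flat, flat, md_congr h, h.self_of_nhds]

theorem flat_comp {f : X → P} {g : X' → X} {x : X'} (hf : MDifferentiableAt I (𝓡 p) f (g x))
    (hg : MDifferentiableAt I' I g x) (Ω : DForm p k P) :
    flat I' (f ∘ g) Ω x = (flat I f Ω (g x)).compContinuousLinearMap (md I' I g x) := by
  rw [flat, flat, md_comp hf hg]; rfl

theorem flat_pullback {q : ℕ} {Q : Type*} [TopologicalSpace Q] [ChartedSpace (Eu q) Q]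
    {f : X → P} {g : P → Q} {x : X} (hg : MDifferentiableAt (𝓡 p) (𝓡 q) g (f x))
    (hf : MDifferentiableAt I (𝓡 p) f x) (Ω : DForm q k Q) :
    flat I f (pullback (p := p) (q := q) g Ω) x = flat I (g ∘ f) Ω x := by
  rw [flat, flat, md_comp hg hf]; rfl

theorem chartRep_eq_flat (Ω : DForm p k P) (y₀ : P) :
    chartRep Ω y₀ = flat 𝓘(ℝ, Eu p) (extChartAt (𝓡 p) y₀).symm Ω := rfl

end Flat

/-! ### Smoothness and closedness of forms in charts -/

section Charts

variable {p : ℕ} {P : Type*} [TopologicalSpace P] [ChartedSpace (Eu p) P]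

variable [IsManifold (𝓡 p) ∞ P]

theorem contMDiffAt_extChartAt_symm {y : P} {u : Eu p} (hu : u ∈ (extChartAt (𝓡 p) y).target) :
    ContMDiffAt 𝓘(ℝ, Eu p) (𝓡 p) ∞ (extChartAt (𝓡 p) y).symm u :=
  (contMDiffOn_extChartAt_symm y).contMDiffAt ((isOpen_extChartAt_target y).mem_nhds hu)

theorem contMDiffAt_extChartAt_source {y y' : P} (hy : y' ∈ (extChartAt (𝓡 p) y).source) :
    ContMDiffAt (𝓡 p) 𝓘(ℝ, Eu p) ∞ (extChartAt (𝓡 p) y) y' :=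
  contMDiffAt_extChartAt' (by simpa using hy)

theorem mdifferentiableAt_extChartAt_symm {y : P} {u : Eu p}
    (hu : u ∈ (extChartAt (𝓡 p) y).target) :
    MDifferentiableAt 𝓘(ℝ, Eu p) (𝓡 p) (extChartAt (𝓡 p) y).symm u :=
  (contMDiffAt_extChartAt_symm hu).mdifferentiableAt (by simp)

theorem mdifferentiableAt_extChartAt_source {y y' : P} (hy : y' ∈ (extChartAt (𝓡 p) y).source) :
    MDifferentiableAt (𝓡 p) 𝓘(ℝ, Eu p) (extChartAt (𝓡 p) y) y' :=
  (contMDiffAt_extChartAt_source hy).mdifferentiableAt (by simp)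

theorem md_extChartAt_comp_symm {y : P} {u : Eu p} (hu : u ∈ (extChartAt (𝓡 p) y).target) :
    md (𝓡 p) 𝓘(ℝ, Eu p) (extChartAt (𝓡 p) y) ((extChartAt (𝓡 p) y).symm u) ∘L
      md 𝓘(ℝ, Eu p) (𝓡 p) (extChartAt (𝓡 p) y).symm u = ContinuousLinearMap.id ℝ _ := by
  rw [← md_comp (mdifferentiableAt_extChartAt_source ((extChartAt (𝓡 p) y).map_target hu))
    (mdifferentiableAt_extChartAt_symm hu), ← md_id (I := 𝓘(ℝ, Eu p)) (x := u)]
  refine md_congr ?_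
  filter_upwards [(isOpen_extChartAt_target y).mem_nhds hu] with u' hu'
  exact (extChartAt (𝓡 p) y).right_inv hu'

theorem md_extChartAt_symm_comp {y y' : P} (hy : y' ∈ (extChartAt (𝓡 p) y).source) :
    md 𝓘(ℝ, Eu p) (𝓡 p) (extChartAt (𝓡 p) y).symm (extChartAt (𝓡 p) y y') ∘L
      md (𝓡 p) 𝓘(ℝ, Eu p) (extChartAt (𝓡 p) y) y' = ContinuousLinearMap.id ℝ _ := by
  rw [← md_comp (mdifferentiableAt_extChartAt_symm ((extChartAt (𝓡 p) y).map_source hy))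
    (mdifferentiableAt_extChartAt_source hy), ← md_id (I := 𝓡 p) (x := y')]
  refine md_congr ?_
  filter_upwards [(isOpen_extChartAt_source y).mem_nhds hy] with u' hu'
  exact (extChartAt (𝓡 p) y).left_inv hu'

/-- `deRham` composes the exterior derivative with the derivative of the chart, which is invertible
and can be cancelled. -/
theorem extDeriv_chartRep_eq_zero {k : ℕ} {Ω : DForm p k P} {y : P} (h : deRham Ω y = 0) :
    extDeriv (chartRep Ω y) (extChartAt (𝓡 p) y y) = 0 := by
  have h1 := md_extChartAt_comp_symm (mem_extChartAt_target (I := 𝓡 p) y)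
  rw [extChartAt_to_inv] at h1
  have h2 : (extDeriv (chartRep Ω y) (extChartAt (𝓡 p) y y)).compContinuousLinearMap
    (md (𝓡 p) 𝓘(ℝ, Eu p) (extChartAt (𝓡 p) y) y) = 0 := h
  ext v
  have h3 := DFunLike.congr_fun h2
    (md 𝓘(ℝ, Eu p) (𝓡 p) (extChartAt (𝓡 p) y).symm (extChartAt (𝓡 p) y y) ∘ v)
  have h4 : (md (𝓡 p) 𝓘(ℝ, Eu p) (extChartAt (𝓡 p) y) y) ∘
    (md 𝓘(ℝ, Eu p) (𝓡 p) (extChartAt (𝓡 p) y).symm (extChartAt (𝓡 p) y y) ∘ v) = v := by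
    ext1 i
    exact DFunLike.congr_fun h1 (v i)
  rw [ContinuousAlternatingMap.compContinuousLinearMap_apply, h4] at h3
  exact h3

variable {E : Type*} [NormedAddCommGroup E] [NormedSpace ℝ E]

/-- Factors `f` near `u` through the preferred chart at `f u`. That chart is the one in which
`deRham` at `f u` is computed, so smoothness and closedness of pull-backs become statements on
vector spaces. -/
theorem flat_eventuallyEq_chartRep {k : ℕ} (Ω : DForm p k P) {f : E → P} {W : Set E}
    (hW : IsOpen W) (hf : ContMDiffOn 𝓘(ℝ, E) (𝓡 p) ∞ f W) {u : E} (hu : u ∈ W) :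
    flat 𝓘(ℝ, E) f Ω =ᶠ[nhds u] fun u' => (chartRep Ω (f u)
      ((extChartAt (𝓡 p) (f u) ∘ f) u')).compContinuousLinearMap
        (fderiv ℝ (extChartAt (𝓡 p) (f u) ∘ f) u') := by
  have h1 : ∀ᶠ u' in nhds u, f u' ∈ (extChartAt (𝓡 p) (f u)).source :=
    (hf.continuousOn.continuousAt (hW.mem_nhds hu)).eventually
      (extChartAt_source_mem_nhds (I := 𝓡 p) (f u))
  filter_upwards [h1.eventually_nhds, hW.mem_nhds hu] with u' hu' huW
  have hfu : MDifferentiableAt 𝓘(ℝ, E) (𝓡 p) f u' :=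
    (hf.contMDiffAt (hW.mem_nhds huW)).mdifferentiableAt (by simp)
  have hs := hu'.self_of_nhds
  have hφ := mdifferentiableAt_extChartAt_source hs
  have hφ' := mdifferentiableAt_extChartAt_symm ((extChartAt (𝓡 p) (f u)).map_source hs)
  rw [chartRep_eq_flat, ← md_vectorSpace]
  refine Eq.trans (flat_congr (g := (extChartAt (𝓡 p) (f u)).symm ∘ (extChartAt (𝓡 p) (f u) ∘ f))
    ?_ Ω) (flat_comp (g := extChartAt (𝓡 p) (f u) ∘ f) hφ' (hφ.comp u' hfu) Ω)
  filter_upwards [hu'] with u'' hu''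
  exact ((extChartAt (𝓡 p) (f u)).left_inv hu'').symm

theorem contDiffAt_extChartAt_comp {f : E → P} {W : Set E}
    (hW : IsOpen W) (hf : ContMDiffOn 𝓘(ℝ, E) (𝓡 p) ∞ f W) {u : E} (hu : u ∈ W) :
    ContDiffAt ℝ ∞ (extChartAt (𝓡 p) (f u) ∘ f) u :=
  ((contMDiffAt_extChartAt_source (mem_extChartAt_source (f u))).comp u
    (hf.contMDiffAt (hW.mem_nhds hu))).contDiffAt

/-- Pull-backs of smooth forms to vector spaces are smooth. -/
theorem IsSmoothForm.contDiffAt_flat {k : ℕ} {Ω : DForm p k P} (hΩ : IsSmoothForm Ω) {f : E → P}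
    {W : Set E} (hW : IsOpen W) (hf : ContMDiffOn 𝓘(ℝ, E) (𝓡 p) ∞ f W) {u : E} (hu : u ∈ W) :
    ContDiffAt ℝ ∞ (flat 𝓘(ℝ, E) f Ω) u := by
  have hg := contDiffAt_extChartAt_comp hW hf hu
  refine ContDiffAt.congr_of_eventuallyEq ?_ (flat_eventuallyEq_chartRep Ω hW hf hu)
  refine ContDiffAt.compContinuousLinearMap_alternating ?_ (hg.fderiv_right (m := ∞) (by simp))
  exact ContDiffAt.comp u ((hΩ (f u)).contDiffAt ((isOpen_extChartAt_target (f u)).mem_nhds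
    (mem_extChartAt_target (f u)))) hg

/-- Pull-backs of closed forms to vector spaces are closed. -/
theorem IsSmoothForm.extDeriv_flat {k : ℕ} {Ω : DForm p k P} (hΩ : IsSmoothForm Ω)
    (hd : ∀ y, deRham Ω y = 0) {f : E → P}
    {W : Set E} (hW : IsOpen W) (hf : ContMDiffOn 𝓘(ℝ, E) (𝓡 p) ∞ f W) {u : E} (hu : u ∈ W) :
    extDeriv (flat 𝓘(ℝ, E) f Ω) u = 0 := by
  have hg := contDiffAt_extChartAt_comp hW hf hu
  have h1 : ContDiffAt ℝ ∞ (chartRep Ω (f u)) ((extChartAt (𝓡 p) (f u) ∘ f) u) :=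
    (hΩ (f u)).contDiffAt ((isOpen_extChartAt_target (f u)).mem_nhds (mem_extChartAt_target (f u)))
  rw [(flat_eventuallyEq_chartRep Ω hW hf hu).extDeriv_eq,
    extDeriv_pullback (h1.differentiableAt (by simp)) hg
      (by simpa using (WithTop.coe_le_coe.2 le_top : ((2 : ℕ∞) : WithTop ℕ∞) ≤ ∞))]
  have h2 := extDeriv_chartRep_eq_zero (hd (f u))
  rw [Function.comp_apply, h2]
  ext v; rfl

end Charts

/-! ### Adapted charts of a fiber bundle -/

section BundleChart

variable {b z f : ℕ} {B : Type*} [TopologicalSpace B] [ChartedSpace (Eu b) B]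
  {Z : Type*} [TopologicalSpace Z] [ChartedSpace (Eu z) Z]

/-- A chart of the total space of a bundle in which the projection, read in the chart of the base at
`x₀`, is a projection of vector spaces. -/
structure BundleChart (b z f : ℕ) {B : Type*} [TopologicalSpace B] [ChartedSpace (Eu b) B]
    {Z : Type*} [TopologicalSpace Z] [ChartedSpace (Eu z) Z] (π : Z → B) (x₀ : B) where
  /-- The chart. -/
  toHomeo : OpenPartialHomeomorph Z (Eu b × Eu f)
  contMDiffOn : ContMDiffOn (𝓡 z) 𝓘(ℝ, Eu b × Eu f) ∞ toHomeo toHomeo.source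
  contMDiffOn_symm : ContMDiffOn 𝓘(ℝ, Eu b × Eu f) (𝓡 z) ∞ toHomeo.symm toHomeo.target
  base_mem : ∀ y ∈ toHomeo.source, π y ∈ (extChartAt (𝓡 b) x₀).source
  fst_apply : ∀ y ∈ toHomeo.source, (toHomeo y).1 = extChartAt (𝓡 b) x₀ (π y)

/-- Composes a trivialization around `π y` with the product of the base chart at `x₀` and a fiber
chart. Keeping `x₀` independent of `y` allows one fixed base chart to be studied at all its points.
-/
theorem IsSmoothFiberBundle.exists_bundleChart [IsManifold (𝓡 b) ∞ B] {π : Z → B}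
    (hπ : IsSmoothFiberBundle b z π) (x₀ : B) (y : Z)
    (hy : π y ∈ (extChartAt (𝓡 b) x₀).source) :
    ∃ (f : ℕ) (Φ : BundleChart b z f π x₀), y ∈ Φ.toHomeo.source := by
  obtain ⟨f, F, _, _, _, e, hx, he, he'⟩ := hπ.2 (π y)
  have hye : y ∈ e.source := e.mem_source.2 hx
  let ch : OpenPartialHomeomorph (B × F) (Eu b × Eu f) :=
    (chartAt (Eu b) x₀).prod (chartAt (Eu f) (e y).2)
  have hch : ContMDiffOn ((𝓡 b).prod (𝓡 f)) 𝓘(ℝ, Eu b × Eu f) ∞ ch ch.source := by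
    have := (contMDiffOn_chart (I := 𝓡 b) (n := ∞) (x := x₀)).prodMap
      (contMDiffOn_chart (I := 𝓡 f) (n := ∞) (x := (e y).2))
    rw [modelWithCornersSelf_prod, ← chartedSpaceSelf_prod]
    exact this
  have hch' : ContMDiffOn 𝓘(ℝ, Eu b × Eu f) ((𝓡 b).prod (𝓡 f)) ∞ ch.symm ch.target := by
    have := (contMDiffOn_chart_symm (I := 𝓡 b) (n := ∞) (x := x₀)).prodMap
      (contMDiffOn_chart_symm (I := 𝓡 f) (n := ∞) (x := (e y).2))
    rw [modelWithCornersSelf_prod, ← chartedSpaceSelf_prod]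
    exact this
  have hsrc : ∀ y' ∈ (e.toOpenPartialHomeomorph.trans ch).source, y' ∈ e.source ∧
      π y' ∈ (chartAt (Eu b) x₀).source := by
    intro y' hy'
    rw [OpenPartialHomeomorph.trans_source] at hy'
    refine ⟨hy'.1, ?_⟩
    have h1 : (e y').1 ∈ (chartAt (Eu b) x₀).source := hy'.2.1
    rwa [e.coe_fst hy'.1] at h1
  refine ⟨f, ⟨e.toOpenPartialHomeomorph.trans ch, ?_, ?_, ?_, ?_⟩, ?_⟩
  · refine hch.comp (he.mono fun y' hy' => (hsrc y' hy').1) fun y' hy' => ?_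
    rw [OpenPartialHomeomorph.trans_source] at hy'
    exact hy'.2
  · refine he'.comp (hch'.mono fun c hc => ?_) fun c hc => ?_
    · rw [OpenPartialHomeomorph.trans_target] at hc
      exact hc.1
    · rw [OpenPartialHomeomorph.trans_target] at hc
      exact hc.2
  · intro y' hy'
    simpa using (hsrc y' hy').2
  · intro y' hy'
    have : (e y').1 = π y' := e.coe_fst (hsrc y' hy').1
    change chartAt (Eu b) x₀ (e y').1 = _
    rw [this]; simp
  · rw [OpenPartialHomeomorph.trans_source]
    refine ⟨hye, ?_, ?_⟩
    · change (e y).1 ∈ (chartAt (Eu b) x₀).source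
      rw [e.coe_fst hye]; simpa using hy
    · exact mem_chart_source (Eu f) (e y).2

namespace BundleChart

variable {π : Z → B} {x₀ : B} (Φ : BundleChart b z f π x₀)

theorem contMDiffAt {y : Z} (hy : y ∈ Φ.toHomeo.source) :
    ContMDiffAt (𝓡 z) 𝓘(ℝ, Eu b × Eu f) ∞ Φ.toHomeo y :=
  Φ.contMDiffOn.contMDiffAt (Φ.toHomeo.open_source.mem_nhds hy)

theorem contMDiffAt_symm {c : Eu b × Eu f} (hc : c ∈ Φ.toHomeo.target) :
    ContMDiffAt 𝓘(ℝ, Eu b × Eu f) (𝓡 z) ∞ Φ.toHomeo.symm c :=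
  Φ.contMDiffOn_symm.contMDiffAt (Φ.toHomeo.open_target.mem_nhds hc)

theorem mdifferentiableAt {y : Z} (hy : y ∈ Φ.toHomeo.source) :
    MDifferentiableAt (𝓡 z) 𝓘(ℝ, Eu b × Eu f) Φ.toHomeo y :=
  (Φ.contMDiffAt hy).mdifferentiableAt (by simp)

theorem mdifferentiableAt_symm {c : Eu b × Eu f} (hc : c ∈ Φ.toHomeo.target) :
    MDifferentiableAt 𝓘(ℝ, Eu b × Eu f) (𝓡 z) Φ.toHomeo.symm c :=
  (Φ.contMDiffAt_symm hc).mdifferentiableAt (by simp)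

theorem fst_mem_target {c : Eu b × Eu f} (hc : c ∈ Φ.toHomeo.target) :
    c.1 ∈ (extChartAt (𝓡 b) x₀).target := by
  have h := Φ.fst_apply _ (Φ.toHomeo.map_target hc)
  rw [Φ.toHomeo.right_inv hc] at h
  rw [h]
  exact (extChartAt (𝓡 b) x₀).map_source (Φ.base_mem _ (Φ.toHomeo.map_target hc))

theorem proj_symm {c : Eu b × Eu f} (hc : c ∈ Φ.toHomeo.target) :
    π (Φ.toHomeo.symm c) = (extChartAt (𝓡 b) x₀).symm c.1 := by
  have h := Φ.fst_apply _ (Φ.toHomeo.map_target hc)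
  rw [Φ.toHomeo.right_inv hc] at h
  rw [h, (extChartAt (𝓡 b) x₀).left_inv (Φ.base_mem _ (Φ.toHomeo.map_target hc))]

theorem md_comp_symm {c : Eu b × Eu f} (hc : c ∈ Φ.toHomeo.target) :
    md (𝓡 z) 𝓘(ℝ, Eu b × Eu f) Φ.toHomeo (Φ.toHomeo.symm c) ∘L
      md 𝓘(ℝ, Eu b × Eu f) (𝓡 z) Φ.toHomeo.symm c = ContinuousLinearMap.id ℝ _ := by
  rw [← md_comp (Φ.mdifferentiableAt (Φ.toHomeo.map_target hc)) (Φ.mdifferentiableAt_symm hc),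
    ← md_id (I := 𝓘(ℝ, Eu b × Eu f)) (x := c)]
  refine md_congr ?_
  filter_upwards [Φ.toHomeo.open_target.mem_nhds hc] with c' hc'
  exact Φ.toHomeo.right_inv hc'

theorem md_symm_comp {y : Z} (hy : y ∈ Φ.toHomeo.source) :
    md 𝓘(ℝ, Eu b × Eu f) (𝓡 z) Φ.toHomeo.symm (Φ.toHomeo y) ∘L
      md (𝓡 z) 𝓘(ℝ, Eu b × Eu f) Φ.toHomeo y = ContinuousLinearMap.id ℝ _ := by
  rw [← md_comp (Φ.mdifferentiableAt_symm (Φ.toHomeo.map_source hy)) (Φ.mdifferentiableAt hy),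
    ← md_id (I := 𝓡 z) (x := y)]
  refine md_congr ?_
  filter_upwards [Φ.toHomeo.open_source.mem_nhds hy] with y' hy'
  exact Φ.toHomeo.left_inv hy'

variable [IsManifold (𝓡 b) ∞ B]

/-- The derivative of `proj_symm`: in the chart, `π` is the first projection followed by the inverse
base chart. -/
theorem md_proj_symm (hπ : ContMDiff (𝓡 z) (𝓡 b) ∞ π) {c : Eu b × Eu f}
    (hc : c ∈ Φ.toHomeo.target) :
    md (𝓡 z) (𝓡 b) π (Φ.toHomeo.symm c) ∘L md 𝓘(ℝ, Eu b × Eu f) (𝓡 z) Φ.toHomeo.symm c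
      = md 𝓘(ℝ, Eu b) (𝓡 b) (extChartAt (𝓡 b) x₀).symm c.1 ∘L
        ContinuousLinearMap.fst ℝ (Eu b) (Eu f) := by
  rw [← md_comp ((hπ _).mdifferentiableAt (by simp)) (Φ.mdifferentiableAt_symm hc)]
  have h1 : md 𝓘(ℝ, Eu b × Eu f) 𝓘(ℝ, Eu b) Prod.fst c = ContinuousLinearMap.fst ℝ _ _ := by
    rw [md_vectorSpace, fderiv_fst]
  rw [← h1, ← md_comp (g := (extChartAt (𝓡 b) x₀).symm)
    (mdifferentiableAt_extChartAt_symm (Φ.fst_mem_target hc))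
    differentiableAt_fst.mdifferentiableAt]
  refine md_congr ?_
  filter_upwards [Φ.toHomeo.open_target.mem_nhds hc] with c' hc'
  exact Φ.proj_symm hc'

end BundleChart

theorem IsSmoothFiberBundle.md_surjective [IsManifold (𝓡 b) ∞ B] {π : Z → B}
    (hπ : IsSmoothFiberBundle b z π) (y : Z) : Function.Surjective (md (𝓡 z) (𝓡 b) π y) := by
  obtain ⟨f, Φ, hy⟩ := hπ.exists_bundleChart (π y) y (mem_extChartAt_source _)
  have h := Φ.md_proj_symm hπ.1 (Φ.toHomeo.map_source hy)
  rw [Φ.toHomeo.left_inv hy] at h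
  have hx : (Φ.toHomeo y).1 ∈ (extChartAt (𝓡 b) (π y)).target :=
    Φ.fst_mem_target (Φ.toHomeo.map_source hy)
  have h' := md_extChartAt_symm_comp (mem_extChartAt_source (I := 𝓡 b) (π y))
  intro w
  -- The preimage of `w` is its lift with zero fiber component.
  refine ⟨md 𝓘(ℝ, Eu b × Eu f) (𝓡 z) Φ.toHomeo.symm (Φ.toHomeo y)
    (md (𝓡 b) 𝓘(ℝ, Eu b) (extChartAt (𝓡 b) (π y)) (π y) w, 0), ?_⟩
  have h1 := DFunLike.congr_fun h (md (𝓡 b) 𝓘(ℝ, Eu b) (extChartAt (𝓡 b) (π y)) (π y) w, 0)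
  refine h1.trans ?_
  rw [Φ.fst_apply y hy]
  exact DFunLike.congr_fun h' w

namespace BundleChart

variable {π : Z → B} {x₀ : B} (Φ : BundleChart b z f π x₀) [IsManifold (𝓡 b) ∞ B]

/-- The vertical vectors are the vectors with vanishing first component in a bundle chart. -/
theorem md_proj_eq_zero_iff (hπ : ContMDiff (𝓡 z) (𝓡 b) ∞ π) {c : Eu b × Eu f}
    (hc : c ∈ Φ.toHomeo.target) (v : Eu b × Eu f) :
    md (𝓡 z) (𝓡 b) π (Φ.toHomeo.symm c)
      (md 𝓘(ℝ, Eu b × Eu f) (𝓡 z) Φ.toHomeo.symm c v) = 0 ↔ v.1 = 0 := by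
  have h1 := DFunLike.congr_fun (Φ.md_proj_symm hπ hc) v
  have h2 := DFunLike.congr_fun (md_extChartAt_comp_symm (Φ.fst_mem_target hc)) v.1
  simp only [ContinuousLinearMap.comp_apply, ContinuousLinearMap.coe_fst',
    ContinuousLinearMap.id_apply] at h1 h2
  rw [h1]
  constructor
  · intro h
    rw [← h2, h, map_zero]
  · intro h
    rw [h, map_zero]

end BundleChart

end BundleChart

/-! ### Alternating forms and surjective linear maps -/

section Algebra

variable {E F : Type*} [NormedAddCommGroup E] [NormedSpace ℝ E]
  [NormedAddCommGroup F] [NormedSpace ℝ F] {k : ℕ}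

theorem compContinuousLinearMap_injective {L : E →L[ℝ] F} (hL : Function.Surjective L) :
    Function.Injective fun η : F [⋀^Fin k]→L[ℝ] ℝ => η.compContinuousLinearMap L := by
  intro η η' h
  ext w
  choose v hv using fun i => hL (w i)
  have h1 := DFunLike.congr_fun h v
  have h2 : L ∘ v = w := funext hv
  simpa only [ContinuousAlternatingMap.compContinuousLinearMap_apply, h2] using h1

/-- The form downstairs is the pull-back of `η` along a linear right inverse `R` of `L`: since `v -
R (L v)` lies in the kernel of `L`, `η` does not see the difference. -/
theorem exists_eq_compContinuousLinearMap [FiniteDimensional ℝ F] {L : E →L[ℝ] F}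
    (hL : Function.Surjective L) (η : E [⋀^Fin (k + 1)]→L[ℝ] ℝ)
    (h : ∀ ξ, L ξ = 0 → ∀ v : Fin k → E, η (Matrix.vecCons ξ v) = 0) :
    ∃ η' : F [⋀^Fin (k + 1)]→L[ℝ] ℝ, η = η'.compContinuousLinearMap L := by
  obtain ⟨R, hR⟩ := L.toLinearMap.exists_rightInverse_of_surjective (LinearMap.range_eq_top.2 hL)
  refine ⟨η.compContinuousLinearMap (LinearMap.toContinuousLinearMap R), ?_⟩
  ext v
  refine alternating_apply_congr (K := LinearMap.ker L.toLinearMap) h fun i => ?_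
  have : L (R (L (v i))) = L (v i) := LinearMap.congr_fun hR (L (v i))
  change L (v i - R (L (v i))) = 0
  rw [map_sub, this, sub_self]

end Algebra

/-! ### Descent of closed forms along a bundle with connected fibers -/

section Descent

variable {b z f k : ℕ} {B : Type*} [TopologicalSpace B] [ChartedSpace (Eu b) B]
  [IsManifold (𝓡 b) ∞ B] {Z : Type*} [TopologicalSpace Z] [ChartedSpace (Eu z) Z] {π : Z → B}
  {Ω : DForm z (k + 1) Z}

/-- In a bundle chart, a closed form annihilated by the vertical vectors is constant along the
fibers. -/
theorem BundleChart.flat_eq_of_fst_eq [IsManifold (𝓡 z) ∞ Z] {x₀ : B} (Φ : BundleChart b z f π x₀)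
    (hπ : ContMDiff (𝓡 z) (𝓡 b) ∞ π) (hΩ : IsSmoothForm Ω) (hd : ∀ y, deRham Ω y = 0)
    (hv : ∀ y ξ, md (𝓡 z) (𝓡 b) π y ξ = 0 → ∀ v : Fin k → Eu z, Ω.at y (Matrix.vecCons ξ v) = 0)
    {c₀ : Eu b × Eu f} {r : ℝ} (hr : Metric.ball c₀ r ⊆ Φ.toHomeo.target) {c : Eu b × Eu f}
    (hc : c ∈ Metric.ball c₀ r) (h1 : c.1 = c₀.1) :
    flat 𝓘(ℝ, Eu b × Eu f) Φ.toHomeo.symm Ω c = flat 𝓘(ℝ, Eu b × Eu f) Φ.toHomeo.symm Ω c₀ := by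
  set θ := flat 𝓘(ℝ, Eu b × Eu f) Φ.toHomeo.symm Ω with hθ
  have hsm : ∀ u ∈ Φ.toHomeo.target, ContDiffAt ℝ ∞ θ u := fun u hu =>
    hΩ.contDiffAt_flat Φ.toHomeo.open_target Φ.contMDiffOn_symm hu
  have hver : ∀ u ∈ Φ.toHomeo.target, ∀ (w : Eu f) (v : Fin k → Eu b × Eu f),
      θ u (Matrix.vecCons (0, w) v) = 0 := by
    intro u hu w v
    have h2 := hv (Φ.toHomeo.symm u) (md 𝓘(ℝ, Eu b × Eu f) (𝓡 z) Φ.toHomeo.symm u (0, w))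
      ((Φ.md_proj_eq_zero_iff hπ hu _).2 rfl)
      (fun i => md 𝓘(ℝ, Eu b × Eu f) (𝓡 z) Φ.toHomeo.symm u (v i))
    rw [hθ, flat, ContinuousAlternatingMap.compContinuousLinearMap_apply, ← h2]
    congr 1
    ext1 i
    refine Fin.cases ?_ (fun i => ?_) i <;> simp
  have hder : ∀ u ∈ Φ.toHomeo.target, ∀ w : Eu f, fderiv ℝ θ u (0, w) = 0 := by
    intro u hu w
    refine fderiv_eq_zero_of_extDeriv_eq_zero ((hsm u hu).differentiableAt (by simp))
      (hΩ.extDeriv_flat hd Φ.toHomeo.open_target Φ.contMDiffOn_symm hu) ?_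
    filter_upwards [Φ.toHomeo.open_target.mem_nhds hu] with u' hu' v
    exact hver u' hu' w v
  have hr0 : 0 < r := (dist_nonneg).trans_lt (Metric.mem_ball.1 hc)
  have hball : ∀ w ∈ Metric.ball c₀.2 r, ((c₀.1, w) : Eu b × Eu f) ∈ Metric.ball c₀ r := by
    intro w hw
    rw [Metric.mem_ball, Prod.dist_eq]
    simpa [hr0] using hw
  -- The slice of the ball over a fixed base coordinate is a ball, hence convex, and `hder` says
  -- that `θ` has zero derivative on it.
  have hg : ∀ w ∈ Metric.ball c₀.2 r, HasFDerivAt (fun w : Eu f => θ (c₀.1, w))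
      (0 : Eu f →L[ℝ] _) w := by
    intro w hw
    have hu := hr (hball w hw)
    have h2 := ((hsm _ hu).differentiableAt (by simp)).hasFDerivAt
    have h3 := h2.comp w (hasFDerivAt_prodMk_right c₀.1 w)
    have h4 : fderiv ℝ θ (c₀.1, w) ∘L ContinuousLinearMap.inr ℝ (Eu b) (Eu f) = 0 := by
      ext1 w'
      exact hder _ hu w'
    rw [h4] at h3
    exact h3
  have h4 := (convex_ball c₀.2 r).is_const_of_fderivWithin_eq_zero (𝕜 := ℝ)
    (f := fun w : Eu f => θ (c₀.1, w))
    (fun w hw => (hg w hw).differentiableAt.differentiableWithinAt)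
    (fun w hw => by
      rw [fderivWithin_of_isOpen Metric.isOpen_ball hw]; exact (hg w hw).fderiv)
    (x := c.2) (y := c₀.2) ?_ (Metric.mem_ball_self hr0)
  · rw [show c = (c₀.1, c.2) from Prod.ext h1 rfl]
    exact h4
  · rw [Metric.mem_ball, Prod.dist_eq] at hc
    exact (le_max_right _ _).trans_lt hc

/-- A closed form annihilated by the vertical vectors of a bundle with connected fibers is the
pull-back of a form on the base. -/
theorem exists_eq_pullback [IsManifold (𝓡 z) ∞ Z] (hπ : IsSmoothFiberBundle b z π)
    (hconn : ∀ x, IsConnected (π ⁻¹' {x})) (hΩ : IsSmoothForm Ω) (hd : ∀ y, deRham Ω y = 0)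
    (hv : ∀ y ξ, md (𝓡 z) (𝓡 b) π y ξ = 0 →
      ∀ v : Fin k → Eu z, Ω.at y (Matrix.vecCons ξ v) = 0) :
    ∃ Ω' : DForm b (k + 1) B, Ω = pullback π Ω' := by
  -- `T y` is the candidate for the descended form at `π y`, computed from `y`. All candidates are
  -- forms on the same model space, so those at points of one fiber can be compared directly.
  choose T hT using fun y => exists_eq_compContinuousLinearMap (hπ.md_surjective y) (Ω.at y) (hv y)
  have hconst : ∀ x, ∀ y ∈ π ⁻¹' {x}, ∀ y' ∈ π ⁻¹' {x}, T y = T y' := by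
    intro x
    have hlc : IsLocallyConstant fun y : π ⁻¹' {x} => T y := by
      rw [IsLocallyConstant.iff_eventually_eq]
      rintro ⟨y, hy⟩
      obtain ⟨f, Φ, hyΦ⟩ := hπ.exists_bundleChart (π y) y (mem_extChartAt_source _)
      obtain ⟨r, hr0, hr⟩ := Metric.isOpen_iff.1 Φ.toHomeo.open_target _ (Φ.toHomeo.map_source hyΦ)
      have hN : ∀ᶠ y' in nhds y, y' ∈ Φ.toHomeo.source ∧
          Φ.toHomeo y' ∈ Metric.ball (Φ.toHomeo y) r := by
        filter_upwards [Φ.toHomeo.open_source.mem_nhds hyΦ,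
          (Φ.toHomeo.continuousAt hyΦ).eventually (Metric.ball_mem_nhds _ hr0)] with y' h1 h2
        exact ⟨h1, h2⟩
      have hN' : ∀ᶠ y' : π ⁻¹' {x} in nhds ⟨y, hy⟩, (y' : Z) ∈ Φ.toHomeo.source ∧
          Φ.toHomeo y' ∈ Metric.ball (Φ.toHomeo y) r :=
        (Continuous.tendsto (f := (Subtype.val : π ⁻¹' {x} → Z)) continuous_subtype_val
          ⟨y, hy⟩).eventually hN
      filter_upwards [hN']
      rintro ⟨y', hy'⟩ ⟨hs, hb⟩
      have hyy : π y' = π y := by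
        rw [show π y' = x from hy', show π y = x from hy]
      have hfst : (Φ.toHomeo y').1 = (Φ.toHomeo y).1 := by
        rw [Φ.fst_apply y' hs, Φ.fst_apply y hyΦ, hyy]
      have hflat := Φ.flat_eq_of_fst_eq hπ.1 hΩ hd hv hr hb hfst
      have hform : ∀ y' ∈ Φ.toHomeo.source,
          flat 𝓘(ℝ, Eu b × Eu f) Φ.toHomeo.symm Ω (Φ.toHomeo y') =
            (T y').compContinuousLinearMap
              (md 𝓘(ℝ, Eu b) (𝓡 b) (extChartAt (𝓡 b) (π y)).symm (Φ.toHomeo y').1 ∘L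
                ContinuousLinearMap.fst ℝ (Eu b) (Eu f)) := by
        intro y' hs
        have h := Φ.md_proj_symm hπ.1 (Φ.toHomeo.map_source hs)
        rw [← h, flat, Φ.toHomeo.left_inv hs, hT]
        rfl
      rw [hform y' hs, hform y hyΦ, hfst] at hflat
      -- Both candidates are pulled back along the same surjection, as the base coordinates of `y`
      -- and `y'` agree.
      refine compContinuousLinearMap_injective ?_ hflat
      have hm := md_extChartAt_symm_comp (mem_extChartAt_source (I := 𝓡 b) (π y))
      intro w
      refine ⟨(md (𝓡 b) 𝓘(ℝ, Eu b) (extChartAt (𝓡 b) (π y)) (π y) w, 0), ?_⟩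
      rw [Φ.fst_apply y hyΦ]
      exact DFunLike.congr_fun hm w
    have : PreconnectedSpace (π ⁻¹' {x}) := Subtype.preconnectedSpace (hconn x).isPreconnected
    intro y hy y' hy'
    exact hlc.apply_eq_of_preconnectedSpace ⟨y, hy⟩ ⟨y', hy'⟩
  choose s hs using fun x => (hconn x).nonempty
  refine ⟨fun x => T (s x), funext fun y => ?_⟩
  change Ω.at y = (T (s (π y))).compContinuousLinearMap (md (𝓡 z) (𝓡 b) π y)
  rw [hconst (π y) (s (π y)) (hs _) y rfl]
  exact hT y

theorem pullback_injective (hπ : IsSmoothFiberBundle b z π) (hs : Function.Surjective π)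
    {Ω₁ Ω₂ : DForm b k B} (h : pullback (p := z) π Ω₁ = pullback π Ω₂) : Ω₁ = Ω₂ := by
  funext x
  obtain ⟨y, rfl⟩ := hs x
  exact compContinuousLinearMap_injective (hπ.md_surjective y) (congrFun h y)

/-- With the fiber coordinate frozen, a bundle chart gives a local section `g` of `π` over the base
chart. As `π ∘ g` is the inverse chart, pulling `π^* Ω'` back along `g` recovers the chart
representative of `Ω'`; smoothness and closedness then descend. -/
theorem chartRep_eventuallyEq_flat (hπ : IsSmoothFiberBundle b z π) (hs : Function.Surjective π)
    (Ω' : DForm b k B) (x₀ : B) {a : Eu b} (ha : a ∈ (extChartAt (𝓡 b) x₀).target) :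
    ∃ (W : Set (Eu b)) (g : Eu b → Z), IsOpen W ∧ a ∈ W ∧ ContMDiffOn 𝓘(ℝ, Eu b) (𝓡 z) ∞ g W ∧
      chartRep Ω' x₀ =ᶠ[nhds a] flat 𝓘(ℝ, Eu b) g (pullback (p := z) π Ω') := by
  obtain ⟨y, hy⟩ := hs ((extChartAt (𝓡 b) x₀).symm a)
  obtain ⟨f, Φ, hyΦ⟩ := hπ.exists_bundleChart x₀ y (by
    rw [hy]; exact (extChartAt (𝓡 b) x₀).map_target ha)
  have hfst : (Φ.toHomeo y).1 = a := by
    rw [Φ.fst_apply y hyΦ, hy, (extChartAt (𝓡 b) x₀).right_inv ha]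
  let j : Eu b → Eu b × Eu f := fun a' => (a', (Φ.toHomeo y).2)
  have hj : ContDiff ℝ ∞ j := contDiff_id.prodMk contDiff_const
  have hW : IsOpen (j ⁻¹' Φ.toHomeo.target) := Φ.toHomeo.open_target.preimage hj.continuous
  have haW : a ∈ j ⁻¹' Φ.toHomeo.target := by
    have : j a = Φ.toHomeo y := Prod.ext hfst.symm rfl
    rw [Set.mem_preimage, this]
    exact Φ.toHomeo.map_source hyΦ
  have hg : ContMDiffOn 𝓘(ℝ, Eu b) (𝓡 z) ∞ (Φ.toHomeo.symm ∘ j) (j ⁻¹' Φ.toHomeo.target) :=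
    Φ.contMDiffOn_symm.comp hj.contMDiff.contMDiffOn fun _ h => h
  refine ⟨_, _, hW, haW, hg, ?_⟩
  filter_upwards [hW.mem_nhds haW] with a' ha'
  rw [flat_pullback ((hπ.1 _).mdifferentiableAt (by simp))
    ((hg.contMDiffAt (hW.mem_nhds ha')).mdifferentiableAt (by simp)), chartRep_eq_flat]
  refine flat_congr ?_ Ω'
  filter_upwards [hW.mem_nhds ha'] with a'' ha''
  exact (Φ.proj_symm ha'').symm

theorem isSmoothForm_of_pullback [IsManifold (𝓡 z) ∞ Z] (hπ : IsSmoothFiberBundle b z π)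
    (hs : Function.Surjective π)
    {Ω' : DForm b k B} (h : IsSmoothForm (pullback (p := z) π Ω')) : IsSmoothForm Ω' := by
  intro x₀ a ha
  obtain ⟨W, g, hW, haW, hg, heq⟩ := chartRep_eventuallyEq_flat hπ hs Ω' x₀ ha
  exact ((h.contDiffAt_flat hW hg haW).congr_of_eventuallyEq heq).contDiffWithinAt

theorem deRham_eq_zero_of_pullback [IsManifold (𝓡 z) ∞ Z] (hπ : IsSmoothFiberBundle b z π)
    (hs : Function.Surjective π)
    {Ω' : DForm b k B} (h : IsSmoothForm (pullback (p := z) π Ω'))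
    (hd : ∀ y, deRham (pullback (p := z) π Ω') y = 0) (x : B) : deRham Ω' x = 0 := by
  obtain ⟨W, g, hW, haW, hg, heq⟩ := chartRep_eventuallyEq_flat hπ hs Ω' x
    (mem_extChartAt_target x)
  have h1 : extDeriv (chartRep Ω' x) (extChartAt (𝓡 b) x x) = 0 := by
    rw [heq.extDeriv_eq]
    exact h.extDeriv_flat hd hW hg haW
  rw [deRham, h1]
  ext v; rfl

end Descent

/-! ### Extending and lifting vector fields inside a distribution -/

section Fields

variable {b z f : ℕ} {B : Type*} [TopologicalSpace B] [ChartedSpace (Eu b) B]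
  {Z : Type*} [TopologicalSpace Z] [ChartedSpace (Eu z) Z]
  [IsManifold (𝓡 z) ∞ Z] {π : Z → B}

/-- A local field with values in a distribution, given in a bundle chart, extends to a global
field with values in the distribution. -/
theorem BundleChart.exists_isSmoothField [T2Space Z] {x₀ : B} (Φ : BundleChart b z f π x₀)
    {T : Set (Eu b × Eu f)} (hT : IsOpen T) {y : Z} (hy : y ∈ Φ.toHomeo.source)
    (hyT : Φ.toHomeo y ∈ T) {V : Eu b × Eu f → Eu b × Eu f} (hV : ContDiffOn ℝ ∞ V T)
    (D : ∀ y : Z, Submodule ℝ (TangentSpace (𝓡 z) y))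
    (hD : ∀ c ∈ T, c ∈ Φ.toHomeo.target →
      md 𝓘(ℝ, Eu b × Eu f) (𝓡 z) Φ.toHomeo.symm c (V c) ∈ D (Φ.toHomeo.symm c)) :
    ∃ X : VField z Z, IsSmoothField X ∧ (∀ y', X y' ∈ D y') ∧
      X y = md 𝓘(ℝ, Eu b × Eu f) (𝓡 z) Φ.toHomeo.symm (Φ.toHomeo y) (V (Φ.toHomeo y)) := by
  let V' : ∀ c : Eu b × Eu f, TangentSpace 𝓘(ℝ, Eu b × Eu f) c := V
  let X₀ : VField z Z := VectorField.mpullback (𝓡 z) 𝓘(ℝ, Eu b × Eu f) Φ.toHomeo V'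
  let O : Set Z := Φ.toHomeo.source ∩ Φ.toHomeo ⁻¹' T
  have hO : IsOpen O := Φ.toHomeo.isOpen_inter_preimage hT
  have hl : ∀ y' ∈ O, md (𝓡 z) 𝓘(ℝ, Eu b × Eu f) Φ.toHomeo y' ∘L
      md 𝓘(ℝ, Eu b × Eu f) (𝓡 z) Φ.toHomeo.symm (Φ.toHomeo y') =
        ContinuousLinearMap.id ℝ _ := by
    intro y' hy'
    have := Φ.md_comp_symm (Φ.toHomeo.map_source hy'.1)
    rwa [Φ.toHomeo.left_inv hy'.1] at this
  have hX₀ : ∀ y' ∈ O, X₀ y' = md 𝓘(ℝ, Eu b × Eu f) (𝓡 z) Φ.toHomeo.symm (Φ.toHomeo y')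
      (V (Φ.toHomeo y')) := by
    intro y' hy'
    exact DFunLike.congr_fun (ContinuousLinearMap.inverse_eq (hl y' hy') (Φ.md_symm_comp hy'.1)) _
  have hsm : ContMDiffOn (𝓡 z) (𝓡 z).tangent ∞
      (fun y' => (⟨y', X₀ y'⟩ : TangentBundle (𝓡 z) Z)) O := by
    intro y' hy'
    refine ContMDiffAt.contMDiffWithinAt ?_
    refine ContMDiffAt.mpullback_vectorField_preimage (n := ∞) (V := V') ?_
      (Φ.contMDiffAt hy'.1) ?_ (by simp)
    · exact contMDiffAt_vectorSpace_iff_contDiffAt.2 (hV.contDiffAt (hT.mem_nhds hy'.2))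
    · exact ContinuousLinearMap.IsInvertible.of_inverse (hl y' hy') (Φ.md_symm_comp hy'.1)
  -- Multiplying by a bump function supported in `O` makes the field global. It stays in `D`, whose
  -- fibers are subspaces, and keeps its value at `y`, where `ρ` is `1`.
  obtain ⟨ρ, -, hρ⟩ := (SmoothBumpFunction.nhds_basis_tsupport (I := 𝓡 z) y).mem_iff.1
    (hO.mem_nhds ⟨hy, hyT⟩)
  refine ⟨fun y' => ρ y' • X₀ y', ?_, ?_, ?_⟩
  · exact ContMDiffOn.smul_section_of_tsupport ρ.contMDiff.contMDiffOn hO hρ hsm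
  · intro y'
    by_cases h : y' ∈ O
    · refine (D y').smul_mem _ ?_
      have := hD (Φ.toHomeo y') h.2 (Φ.toHomeo.map_source h.1)
      rw [Φ.toHomeo.left_inv h.1] at this
      rw [hX₀ y' h]
      exact this
    · have : ρ y' = 0 := image_eq_zero_of_notMem_tsupport fun h' => h (hρ h')
      change ρ y' • X₀ y' ∈ D y'
      rw [this, zero_smul]
      exact (D y').zero_mem
  · change ρ y • X₀ y = _
    rw [ρ.eq_one, one_smul, hX₀ y ⟨hy, hyT⟩]

/-- A field on the base of a bundle all of whose lifts are in a distribution lifts to a field in the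
distribution through any given point. -/
theorem IsSmoothFiberBundle.exists_lift [IsManifold (𝓡 b) ∞ B] [T2Space Z]
    (hπ : IsSmoothFiberBundle b z π)
    {Y : VField b B} (hY : IsSmoothField Y) (D : ∀ y : Z, Submodule ℝ (TangentSpace (𝓡 z) y))
    (hD : ∀ y ξ, md (𝓡 z) (𝓡 b) π y ξ = Y (π y) → ξ ∈ D y) (y : Z) :
    ∃ X : VField z Z, IsSmoothField X ∧ (∀ y', X y' ∈ D y') ∧
      md (𝓡 z) (𝓡 b) π y (X y) = Y (π y) := by
  obtain ⟨f, Φ, hy⟩ := hπ.exists_bundleChart (π y) y (mem_extChartAt_source _)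
  let φ := extChartAt (𝓡 b) (π y)
  let V₀ : Eu b → Eu b := VectorField.mpullback 𝓘(ℝ, Eu b) (𝓡 b) φ.symm Y
  have hinv : ∀ a ∈ φ.target, md 𝓘(ℝ, Eu b) (𝓡 b) φ.symm a ∘L
      md (𝓡 b) 𝓘(ℝ, Eu b) φ (φ.symm a) = ContinuousLinearMap.id ℝ _ := by
    intro a ha
    have := md_extChartAt_symm_comp (φ.map_target ha)
    rwa [φ.right_inv ha] at this
  have hV₀ : ∀ a ∈ φ.target, md 𝓘(ℝ, Eu b) (𝓡 b) φ.symm a (V₀ a) = Y (φ.symm a) := by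
    intro a ha
    have h1 : V₀ a = md (𝓡 b) 𝓘(ℝ, Eu b) φ (φ.symm a) (Y (φ.symm a)) :=
      DFunLike.congr_fun (ContinuousLinearMap.inverse_eq (hinv a ha) (md_extChartAt_comp_symm ha)) _
    rw [h1]
    exact DFunLike.congr_fun (hinv a ha) _
  have hsm : ContDiffOn ℝ ∞ V₀ φ.target := by
    intro a ha
    refine ContDiffAt.contDiffWithinAt (contMDiffAt_vectorSpace_iff_contDiffAt.1 ?_)
    refine ContMDiffAt.mpullback_vectorField_preimage (n := ∞) (V := Y) (hY _)
      (contMDiffAt_extChartAt_symm ha) ?_ (by simp)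
    exact ContinuousLinearMap.IsInvertible.of_inverse (hinv a ha) (md_extChartAt_comp_symm ha)
  have hlift : ∀ c ∈ Φ.toHomeo.target, md (𝓡 z) (𝓡 b) π (Φ.toHomeo.symm c)
      (md 𝓘(ℝ, Eu b × Eu f) (𝓡 z) Φ.toHomeo.symm c (V₀ c.1, 0)) = Y (π (Φ.toHomeo.symm c)) := by
    intro c hc
    refine (DFunLike.congr_fun (Φ.md_proj_symm hπ.1 hc) (V₀ c.1, 0)).trans ?_
    rw [Φ.proj_symm hc]
    exact hV₀ c.1 (Φ.fst_mem_target hc)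
  -- The local lift has zero fiber component. After the cut-off, the field is claimed to project to
  -- `Y` only at `y`.
  obtain ⟨X, hX, hXD, hXy⟩ := Φ.exists_isSmoothField Φ.toHomeo.open_target hy
    (Φ.toHomeo.map_source hy) (V := fun c => (V₀ c.1, 0))
    ((hsm.comp contDiff_fst.contDiffOn fun c hc => Φ.fst_mem_target hc).prodMk contDiffOn_const) D
    (fun c _ hc => hD _ _ (hlift c hc))
  refine ⟨X, hX, hXD, ?_⟩
  have := hlift (Φ.toHomeo y) (Φ.toHomeo.map_source hy)
  rw [Φ.toHomeo.left_inv hy] at this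
  rw [hXy]
  exact this

end Fields

/-! ### Vertical vectors, kernels and solutions under the projection -/

section Projection

variable {n p q k : ℕ} {M : Type*} [TopologicalSpace M] [ChartedSpace (Eu n) M]
  {P : Type*} [TopologicalSpace P] [ChartedSpace (Eu p) P]
  {Q : Type*} [TopologicalSpace Q] [ChartedSpace (Eu q) Q]
  {α : P → M} {αQ : Q → M} {π : P → Q}

theorem mem_vertical_iff_of_comp (hcomp : ∀ y, αQ (π y) = α y) {y : P}
    (hαQ : MDifferentiableAt (𝓡 q) (𝓡 n) αQ (π y)) (hπ : MDifferentiableAt (𝓡 p) (𝓡 q) π y)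
    (ξ : Eu p) :
    ξ ∈ (vertical n α y : Submodule ℝ (Eu p)) ↔
      md (𝓡 p) (𝓡 q) π y ξ ∈ (vertical n αQ (π y) : Submodule ℝ (Eu q)) := by
  have h : md (𝓡 p) (𝓡 n) α y = md (𝓡 q) (𝓡 n) αQ (π y) ∘L md (𝓡 p) (𝓡 q) π y := by
    rw [← md_comp hαQ hπ]
    congr 1
    exact (funext hcomp).symm
  change md (𝓡 p) (𝓡 n) α y ξ = 0 ↔ md (𝓡 q) (𝓡 n) αQ (π y) (md (𝓡 p) (𝓡 q) π y ξ) = 0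
  rw [h]; rfl

/-- Surjectivity of the derivative lifts any tuple downstairs, and by `hv` the lift has the same
vertical entries. -/
theorem comp_mem_verticalFiltration_iff {y : P}
    (hs : Function.Surjective (md (𝓡 p) (𝓡 q) π y))
    (hv : ∀ ξ : Eu p, ξ ∈ (vertical n α y : Submodule ℝ (Eu p)) ↔
      md (𝓡 p) (𝓡 q) π y ξ ∈ (vertical n αQ (π y) : Submodule ℝ (Eu q)))
    (η : Eu q [⋀^Fin k]→L[ℝ] ℝ) (r : ℕ) :
    η.compContinuousLinearMap (md (𝓡 p) (𝓡 q) π y) ∈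
        (verticalFiltration n k α y r : Submodule ℝ (Eu p [⋀^Fin k]→L[ℝ] ℝ)) ↔
      η ∈ (verticalFiltration n k αQ (π y) r : Submodule ℝ (Eu q [⋀^Fin k]→L[ℝ] ℝ)) := by
  constructor
  · intro h w s hr hw
    choose v hvw using fun i => hs (w i)
    have h1 := h v s hr fun i hi => (hv (v i)).2 (by rw [hvw i]; exact hw i hi)
    have h2 : md (𝓡 p) (𝓡 q) π y ∘ v = w := funext hvw
    rw [← h2]
    exact h1
  · intro h v s hr hvv
    exact h (md (𝓡 p) (𝓡 q) π y ∘ v) s hr fun i hi => (hv (v i)).1 (hvv i hi)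

theorem interior_pullback (Ω' : DForm q (k + 1) Q) (y : P) (ξ : Eu p) :
    (interior (pullback π Ω' y) ξ : Eu p [⋀^Fin k]→L[ℝ] ℝ) =
      ContinuousAlternatingMap.compContinuousLinearMap
        (interior (Ω' (π y)) (md (𝓡 p) (𝓡 q) π y ξ) : Eu q [⋀^Fin k]→L[ℝ] ℝ)
        (md (𝓡 p) (𝓡 q) π y) := by
  exact ContinuousAlternatingMap.curryLeft_compContinuousLinearMap (Ω'.at (π y))
    (md (𝓡 p) (𝓡 q) π y) ξ

/-- Insertion commutes with pull-back, and the vertical filtration is preserved and reflected.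
Consequently every lift of a vector in the linear kernel is again in the linear kernel, which makes
lifting fields effective. -/
theorem mem_linDist_pullback_iff (hcomp : ∀ y, αQ (π y) = α y) {y : P}
    (hαQ : MDifferentiableAt (𝓡 q) (𝓡 n) αQ (π y)) (hπ : MDifferentiableAt (𝓡 p) (𝓡 q) π y)
    (hs : Function.Surjective (md (𝓡 p) (𝓡 q) π y)) (Ω' : DForm q (n + 1) Q) (ξ : Eu p) :
    ξ ∈ (linDist α (pullback π Ω') y : Submodule ℝ (Eu p)) ↔
      md (𝓡 p) (𝓡 q) π y ξ ∈ (linDist αQ Ω' (π y) : Submodule ℝ (Eu q)) := by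
  have hv := mem_vertical_iff_of_comp hcomp hαQ hπ
  refine and_congr (hv ξ) ?_
  exact (iff_of_eq (congrArg (fun η : Eu p [⋀^Fin n]→L[ℝ] ℝ =>
    η ∈ (verticalFiltration n n α y 0 : Submodule ℝ (Eu p [⋀^Fin n]→L[ℝ] ℝ)))
    (interior_pullback Ω' y ξ))).trans (comp_mem_verticalFiltration_iff hs hv
      (interior (Ω' (π y)) (md (𝓡 p) (𝓡 q) π y ξ)) 0)

theorem dist_le_linDist (α : P → M) (Ω : DForm p (n + 1) P) (y : P) :
    dist α Ω y ≤ linDist α Ω y := by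
  rintro ξ ⟨h1, h2⟩
  refine ⟨h1, ?_⟩
  have h2' : interior (Ω y) ξ = 0 := h2
  change interior (Ω y) ξ ∈ verticalFiltration n n α y 0
  rw [h2']
  exact Submodule.zero_mem _

theorem solvesPDHamilton_iff {Ω : DForm p (n + 1) P} {U : Set M} {σ : M → P} :
    SolvesPDHamilton α Ω U σ ↔ ∀ x ∈ U, ∀ ξ : Eu p, md (𝓡 p) (𝓡 n) α (σ x) ξ = 0 →
      ∀ v : Fin n → Eu n,
        Ω.at (σ x) (Matrix.vecCons ξ (md (𝓡 n) (𝓡 p) σ x ∘ v)) = 0 := by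
  refine forall₂_congr fun x _ => ⟨fun h ξ hξ v => ?_, fun h => ?_⟩
  · exact DFunLike.congr_fun (congrFun h ⟨ξ, hξ⟩) v
  · funext ξ
    ext v
    exact h ξ.1 ξ.2 v

/-- By the chain rule the two equations coincide for `ξ` upstairs and its image downstairs; these
images exhaust the vertical vectors. -/
theorem solvesPDHamilton_pullback_iff (hcomp : ∀ y, αQ (π y) = α y)
    (hαQ : MDifferentiable (𝓡 q) (𝓡 n) αQ) (hπ : MDifferentiable (𝓡 p) (𝓡 q) π)
    (hs : ∀ y, Function.Surjective (md (𝓡 p) (𝓡 q) π y)) (Ω' : DForm q (n + 1) Q)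
    {U : Set M} {σ : M → P} (hσ : ∀ x ∈ U, MDifferentiableAt (𝓡 n) (𝓡 p) σ x) :
    SolvesPDHamilton α (pullback (p := p) (q := q) π Ω') U σ ↔
      SolvesPDHamilton αQ Ω' U (π ∘ σ) := by
  rw [solvesPDHamilton_iff, solvesPDHamilton_iff]
  refine forall₂_congr fun x hx => ?_
  have hv := mem_vertical_iff_of_comp (n := n) hcomp (hαQ _) (hπ (σ x))
  have key : ∀ (ξ : Eu p) (v : Fin n → Eu n),
      (pullback (p := p) π Ω').at (σ x) (Matrix.vecCons ξ (md (𝓡 n) (𝓡 p) σ x ∘ v)) =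
        Ω'.at (π (σ x)) (Matrix.vecCons (md (𝓡 p) (𝓡 q) π (σ x) ξ)
          (md (𝓡 n) (𝓡 q) (π ∘ σ) x ∘ v)) := by
    intro ξ v
    rw [md_comp (hπ (σ x)) (hσ x hx)]
    change Ω'.at (π (σ x)) (md (𝓡 p) (𝓡 q) π (σ x) ∘
      Matrix.vecCons ξ (md (𝓡 n) (𝓡 p) σ x ∘ v)) = _
    congr 1
    ext1 i
    refine Fin.cases ?_ (fun i => ?_) i <;> simp
  constructor
  · intro h ζ hζ v
    obtain ⟨ξ, rfl⟩ := hs (σ x) ζ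
    exact (key ξ v).symm.trans (h ξ ((hv ξ).2 hζ) v)
  · intro h ξ hξ v
    exact (key ξ v).trans (h _ ((hv ξ).1 hξ) v)

end Projection

/-! ### Extension of kernel vectors in the constant rank case -/

section ConstantRank

variable {n p f : ℕ} {M : Type*} [TopologicalSpace M] [ChartedSpace (Eu n) M]
  [IsManifold (𝓡 n) ∞ M] {P : Type*} [TopologicalSpace P] [ChartedSpace (Eu p) P] {α : P → M}

/-- The linear map sending `w` to the multilinear forms obtained from `η` by inserting `(0, w)` and
projecting one of the other arguments to the second factor. -/
noncomputable def linInsertion (n f : ℕ) (η : (Eu n × Eu f) [⋀^Fin (n + 1)]→L[ℝ] ℝ) :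
    Eu f →L[ℝ] (Fin n → ContinuousMultilinearMap ℝ (fun _ : Fin n => Eu n × Eu f) ℝ) :=
  (ContinuousLinearMap.pi fun i =>
    (ContinuousMultilinearMap.compContinuousLinearMapL fun j : Fin n =>
      if j = i then (0 : Eu n →L[ℝ] Eu n).prodMap (ContinuousLinearMap.id ℝ (Eu f))
        else ContinuousLinearMap.id ℝ (Eu n × Eu f)) ∘L
      ContinuousAlternatingMap.toContinuousMultilinearMapCLM ℝ) ∘L
    (η.curryLeft ∘L
      ContinuousLinearMap.inr ℝ (Eu n) (Eu f))

theorem contDiff_curryLeft (E : Type*) [NormedAddCommGroup E] [NormedSpace ℝ E] (n : ℕ) :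
    ContDiff ℝ ∞ fun η : E [⋀^Fin (n + 1)]→L[ℝ] ℝ => η.curryLeft :=
  IsBoundedLinearMap.contDiff ⟨⟨ContinuousAlternatingMap.curryLeft_add,
    ContinuousAlternatingMap.curryLeft_smul⟩, 1, one_pos, fun η => by simp⟩

theorem contDiff_linInsertion (n f : ℕ) : ContDiff ℝ ∞ (linInsertion n f) :=
  contDiff_const.clm_comp ((contDiff_curryLeft (Eu n × Eu f) n).clm_comp contDiff_const)

theorem linInsertion_apply (η : (Eu n × Eu f) [⋀^Fin (n + 1)]→L[ℝ] ℝ) (w : Eu f) (i : Fin n)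
    (u : Fin n → Eu n × Eu f) :
    linInsertion n f η w i u =
      η (Matrix.vecCons (0, w) fun j => if j = i then (0, (u j).2) else u j) := by
  change η (Matrix.vecCons (0, w) _) = _
  congr 2
  ext1 j
  split_ifs <;> simp_all

/-- Projecting the `i`-th argument to the fiber factor produces exactly the tuples with vertical
`i`-th entry. Doing this for every `i` presents `linDist` as the kernel of a linear map on a fixed
space, depending smoothly on the point when the form is smooth. -/
theorem BundleChart.mem_linDist_iff {x₀ : M} (Φ : BundleChart n p f α x₀)
    (hα : ContMDiff (𝓡 p) (𝓡 n) ∞ α) (Ω : DForm p (n + 1) P) {c : Eu n × Eu f}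
    (hc : c ∈ Φ.toHomeo.target) (v : Eu n × Eu f) :
    md 𝓘(ℝ, Eu n × Eu f) (𝓡 p) Φ.toHomeo.symm c v ∈
        (linDist α Ω (Φ.toHomeo.symm c) : Submodule ℝ (Eu p)) ↔
      v.1 = 0 ∧
        linInsertion n f (flat 𝓘(ℝ, Eu n × Eu f) Φ.toHomeo.symm Ω c) v.2 = 0 := by
  set L := md 𝓘(ℝ, Eu n × Eu f) (𝓡 p) Φ.toHomeo.symm c with hL
  have hvert : ∀ u, L u ∈ (vertical n α (Φ.toHomeo.symm c) : Submodule ℝ (Eu p)) ↔ u.1 = 0 :=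
    Φ.md_proj_eq_zero_iff hα hc
  have hsurj : ∀ ξ, ∃ u, L u = ξ := by
    intro ξ
    have h := Φ.md_symm_comp (Φ.toHomeo.map_target hc)
    rw [Φ.toHomeo.right_inv hc] at h
    exact ⟨_, DFunLike.congr_fun h ξ⟩
  have key : ∀ u : Fin n → Eu n × Eu f,
      flat 𝓘(ℝ, Eu n × Eu f) Φ.toHomeo.symm Ω c (Matrix.vecCons v u) =
        Ω.at (Φ.toHomeo.symm c) (Matrix.vecCons (L v) (L ∘ u)) := by
    intro u
    rw [flat, ContinuousAlternatingMap.compContinuousLinearMap_apply]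
    congr 1
    ext1 i
    refine Fin.cases ?_ (fun i => ?_) i <;> simp [hL]
  refine and_congr (hvert v) Iff.rfl |>.trans (and_congr_right fun hv => ?_)
  have hv' : v = (0, v.2) := Prod.ext hv rfl
  constructor
  · intro h
    funext i
    ext u
    rw [linInsertion_apply, ← hv', key]
    refine h (L ∘ fun j => if j = i then (0, (u j).2) else u j) {i} (by simp) fun j hj => ?_
    rw [Finset.mem_singleton] at hj
    subst hj
    exact (hvert _).2 (by simp)
  · intro h w s hs hw
    obtain ⟨i, hi⟩ := Finset.card_pos.1 hs
    choose u hu using fun j => hsurj (w j)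
    have h1 := DFunLike.congr_fun (congrFun h i) u
    rw [linInsertion_apply, ← hv', key] at h1
    have h2 : (L ∘ fun j => if j = i then (0, (u j).2) else u j) = w := by
      ext1 j
      rw [← hu j]
      by_cases hj : j = i
      · subst hj
        have h3 : (u j).1 = 0 := (hvert _).1 (by rw [hu j]; exact hw j hi)
        simp [← h3]
      · simp [hj]
    rw [h2] at h1
    exact h1

/-- If the linear part of an affine form has constant rank, then the vectors of its kernel extend to
fields in its kernel. -/
theorem exists_isSmoothField_linDist [IsManifold (𝓡 p) ∞ P] [T2Space P]
    (hα : IsSmoothFiberBundle n p α)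
    {Ω : DForm p (n + 1) P} (hΩ : IsSmoothForm Ω) {r : ℕ}
    (hr : ∀ y, Module.finrank ℝ (linDist α Ω y) = r) (y : P) (ξ : Eu p)
    (hξ : ξ ∈ (linDist α Ω y : Submodule ℝ (Eu p))) :
    ∃ X : VField p P, IsSmoothField X ∧ (∀ y', X y' ∈ linDist α Ω y') ∧ X y = ξ := by
  obtain ⟨f, Φ, hy⟩ := hα.exists_bundleChart (α y) y (mem_extChartAt_source _)
  set A := fun c => linInsertion n f (flat 𝓘(ℝ, Eu n × Eu f) Φ.toHomeo.symm Ω c) with hA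
  have hAsm : ContDiffOn ℝ ∞ A Φ.toHomeo.target := by
    intro c hc
    have h1 := hΩ.contDiffAt_flat Φ.toHomeo.open_target Φ.contMDiffOn_symm hc
    exact ((contDiff_linInsertion n f).contDiffAt.comp c h1).contDiffWithinAt
  have hrank : ∀ c ∈ Φ.toHomeo.target,
      Module.finrank ℝ (LinearMap.ker (A c).toLinearMap) = r := by
    intro c hc
    let j : Eu f →ₗ[ℝ] Eu p := (md 𝓘(ℝ, Eu n × Eu f) (𝓡 p) Φ.toHomeo.symm c).toLinearMap ∘ₗ
      LinearMap.inr ℝ (Eu n) (Eu f)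
    have hj : Function.Injective j := by
      have h := Φ.md_comp_symm hc
      intro w w' hw
      have h1 := DFunLike.congr_fun h (0, w)
      have h2 := DFunLike.congr_fun h (0, w')
      have hw' : md 𝓘(ℝ, Eu n × Eu f) (𝓡 p) Φ.toHomeo.symm c (0, w)
        = md 𝓘(ℝ, Eu n × Eu f) (𝓡 p) Φ.toHomeo.symm c (0, w') := hw
      simp only [ContinuousLinearMap.comp_apply, ContinuousLinearMap.id_apply] at h1 h2
      rw [hw', h2] at h1
      exact (congrArg Prod.snd h1).symm
    -- The chart carries the kernel of `A c` isomorphically onto `linDist`, so the rank hypothesis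
    -- transfers to the family `A`.
    have hmap : (LinearMap.ker (A c).toLinearMap).map j =
        (linDist α Ω (Φ.toHomeo.symm c) : Submodule ℝ (Eu p)) := by
      ext ξ'
      constructor
      · rintro ⟨w, hw, rfl⟩
        exact (Φ.mem_linDist_iff hα.1 Ω hc (0, w)).2 ⟨rfl, hw⟩
      · intro h
        have h3 := Φ.md_symm_comp (Φ.toHomeo.map_target hc)
        rw [Φ.toHomeo.right_inv hc] at h3
        have h4 := DFunLike.congr_fun h3 ξ'
        simp only [ContinuousLinearMap.comp_apply, ContinuousLinearMap.id_apply] at h4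
        rw [← h4] at h
        obtain ⟨h5, h6⟩ := (Φ.mem_linDist_iff hα.1 Ω hc _).1 h
        refine ⟨_, h6, ?_⟩
        refine Eq.trans ?_ h4
        exact congrArg (md 𝓘(ℝ, Eu n × Eu f) (𝓡 p) Φ.toHomeo.symm c) (Prod.ext h5.symm rfl)
    rw [(Submodule.equivMapOfInjective j hj _).finrank_eq, hmap]
    exact hr _
  have hc₀ := Φ.toHomeo.map_source hy
  have hinv := DFunLike.congr_fun (Φ.md_symm_comp hy) ξ
  simp only [ContinuousLinearMap.comp_apply, ContinuousLinearMap.id_apply] at hinv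
  have hmem := (Φ.mem_linDist_iff hα.1 Ω hc₀
    (md (𝓡 p) 𝓘(ℝ, Eu n × Eu f) Φ.toHomeo y ξ)).1 (by
      rw [hinv, Φ.toHomeo.left_inv hy]; exact hξ)
  obtain ⟨T, hTs, hT, hyT, w, hw, hw₀, hAw⟩ := exists_contDiffOn_mem_ker Φ.toHomeo.open_target
    hAsm hc₀ hrank hmem.2
  obtain ⟨X, hX, hXD, hXy⟩ := Φ.exists_isSmoothField hT hy hyT (V := fun c => (0, w c))
    (contDiffOn_const.prodMk hw) (linDist α Ω)
    (fun c hc hc' => (Φ.mem_linDist_iff hα.1 Ω hc' (0, w c)).2 ⟨rfl, hAw c hc⟩)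
  refine ⟨X, hX, hXD, hXy.trans ?_⟩
  refine Eq.trans ?_ hinv
  exact congrArg (md 𝓘(ℝ, Eu n × Eu f) (𝓡 p) Φ.toHomeo.symm (Φ.toHomeo y))
    (Prod.ext hmem.1.symm hw₀)

end ConstantRank

end PDHam

/-! ### The gauge reduction theorem -/

theorem mainTheorem3 {n p q : ℕ}
    {M : Type*} [TopologicalSpace M] [T2Space M] [SecondCountableTopology M]
    [ChartedSpace (EuclideanSpace ℝ (Fin n)) M] [IsManifold (𝓡 n) ∞ M]
    {P : Type*} [TopologicalSpace P] [T2Space P] [SecondCountableTopology P]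
    [ChartedSpace (EuclideanSpace ℝ (Fin p)) P] [IsManifold (𝓡 p) ∞ P]
    {Q : Type*} [TopologicalSpace Q] [T2Space Q] [SecondCountableTopology Q]
    [ChartedSpace (EuclideanSpace ℝ (Fin q)) Q] [IsManifold (𝓡 q) ∞ Q]
    (α : P → M) (hα : PDHam.IsSmoothFiberBundle n p α)
    (Ω : PDHam.DForm p (n + 1) P) (hΩ : PDHam.IsPDPrehamiltonian α Ω)
    (hker : PDHam.kerForm α Ω = PDHam.kerLin α Ω)
    (αQ : Q → M) (hαQ : PDHam.IsSmoothFiberBundle n q αQ)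
    (𝔭 : P → Q) (h𝔭 : PDHam.IsSmoothFiberBundle q p 𝔭) (hcomp : ∀ y, αQ (𝔭 y) = α y)
    (hleaves : PDHam.FibersAreLeaves q 𝔭 (PDHam.dist α Ω)) :
    ∃ ΩQ : PDHam.DForm q (n + 1) Q,
      (PDHam.IsPDHamiltonian αQ ΩQ ∧ Ω = PDHam.pullback 𝔭 ΩQ ∧
        PDHam.kerForm αQ ΩQ = {0} ∧ PDHam.kerLin αQ ΩQ = {0}) ∧
      (∀ Ω' : PDHam.DForm q (n + 1) Q,
        PDHam.IsPDHamiltonian αQ Ω' → Ω = PDHam.pullback 𝔭 Ω' → Ω' = ΩQ) ∧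
      (∀ (U : Set M) (σ : M → P), PDHam.IsLocalSection n p α U σ →
        PDHam.IsLocalSection n q αQ U (𝔭 ∘ σ) ∧
        (PDHam.SolvesPDHamilton α Ω U σ ↔ PDHam.SolvesPDHamilton αQ ΩQ U (𝔭 ∘ σ))) ∧
      ((∃ r : ℕ, ∀ y, Module.finrank ℝ (PDHam.linDist α Ω y) = r) →
        ∀ z, PDHam.linDist αQ ΩQ z = ⊥) := by
  have hv𝔭 : ∀ y ξ, PDHam.md (𝓡 p) (𝓡 q) 𝔭 y ξ = 0 ↔
      ξ ∈ (PDHam.dist α Ω y : Submodule ℝ (PDHam.Eu p)) := fun y ξ => by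
    rw [← hleaves.2 y]; rfl
  have hsurj : Function.Surjective 𝔭 := fun z => (hleaves.1 z).nonempty
  have hmd := h𝔭.md_surjective
  have hαQ' : MDifferentiable (𝓡 q) (𝓡 n) αQ := hαQ.1.mdifferentiable (by simp)
  have h𝔭' : MDifferentiable (𝓡 p) (𝓡 q) 𝔭 := h𝔭.1.mdifferentiable (by simp)
  obtain ⟨ΩQ, hpull⟩ := PDHam.exists_eq_pullback h𝔭 hleaves.1 hΩ.1 hΩ.2.2 (fun y ξ hξ v =>
    DFunLike.congr_fun ((hv𝔭 y ξ).1 hξ).2 v)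
  subst hpull
  have hlin : ∀ y ξ, ξ ∈ (PDHam.linDist α (PDHam.pullback 𝔭 ΩQ) y : Submodule ℝ (PDHam.Eu p)) ↔
      PDHam.md (𝓡 p) (𝓡 q) 𝔭 y ξ ∈ (PDHam.linDist αQ ΩQ (𝔭 y) : Submodule ℝ (PDHam.Eu q)) :=
    fun y ξ => PDHam.mem_linDist_pullback_iff hcomp (hαQ' _) (h𝔭' y) (hmd y) ΩQ ξ
  -- The equality of kernels is a statement about global fields only, which is why vectors must
  -- first be extended to global fields before it applies.
  have hfield : ∀ X : PDHam.VField p P, PDHam.IsSmoothField X →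
      (∀ y, X y ∈ PDHam.linDist α (PDHam.pullback 𝔭 ΩQ) y) →
      ∀ y, PDHam.md (𝓡 p) (𝓡 q) 𝔭 y (X y) = 0 := by
    intro X hX hXD y
    have : X ∈ PDHam.kerForm α (PDHam.pullback 𝔭 ΩQ) := by
      rw [hker]; exact ⟨hX, hXD⟩
    exact (hv𝔭 y (X y)).2 (this.2 y)
  have hzero : PDHam.IsSmoothField (0 : PDHam.VField q Q) := Bundle.contMDiff_zeroSection ℝ _
  have hkerLin : PDHam.kerLin αQ ΩQ = {0} := by
    refine Set.eq_singleton_iff_unique_mem.2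
      ⟨⟨hzero, fun z => (PDHam.linDist αQ ΩQ z).zero_mem⟩, ?_⟩
    rintro Y ⟨hY, hYD⟩
    funext z
    obtain ⟨y, rfl⟩ := hsurj z
    obtain ⟨X, hX, hXD, hXy⟩ := h𝔭.exists_lift hY (PDHam.linDist α (PDHam.pullback 𝔭 ΩQ))
      (fun y ξ hξ => (hlin y ξ).2 (by rw [hξ]; exact hYD _)) y
    exact hXy.symm.trans (hfield X hX hXD y)
  have hkerForm : PDHam.kerForm αQ ΩQ = {0} := by
    refine Set.eq_singleton_iff_unique_mem.2
      ⟨⟨hzero, fun z => (PDHam.dist αQ ΩQ z).zero_mem⟩, ?_⟩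
    rintro Y ⟨hY, hYD⟩
    have : Y ∈ PDHam.kerLin αQ ΩQ := ⟨hY, fun z => PDHam.dist_le_linDist αQ ΩQ z (hYD z)⟩
    rwa [hkerLin] at this
  have hpre : PDHam.IsPDPrehamiltonian αQ ΩQ := by
    refine ⟨PDHam.isSmoothForm_of_pullback h𝔭 hsurj hΩ.1, fun z => ?_,
      PDHam.deRham_eq_zero_of_pullback h𝔭 hsurj hΩ.1 hΩ.2.2⟩
    obtain ⟨y, rfl⟩ := hsurj z
    exact (PDHam.comp_mem_verticalFiltration_iff (hmd y)
      (PDHam.mem_vertical_iff_of_comp hcomp (hαQ' _) (h𝔭' y)) (ΩQ (𝔭 y)) 2).1 (hΩ.2.1 y)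
  refine ⟨ΩQ, ⟨⟨hpre, hkerLin⟩, rfl, hkerForm, hkerLin⟩, ?_, ?_, ?_⟩
  · intro Ω' _ h
    exact (PDHam.pullback_injective h𝔭 hsurj h).symm
  · rintro U σ ⟨hU, hσ, hsec⟩
    refine ⟨⟨hU, h𝔭.1.comp_contMDiffOn hσ, fun x hx => (hcomp _).trans (hsec x hx)⟩, ?_⟩
    exact PDHam.solvesPDHamilton_pullback_iff hcomp hαQ' h𝔭' hmd ΩQ fun x hx =>
      (hσ.contMDiffAt (hU.mem_nhds hx)).mdifferentiableAt (by simp)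
  · rintro ⟨r, hr⟩ z
    obtain ⟨y, rfl⟩ := hsurj z
    refine (Submodule.eq_bot_iff _).2 fun ζ hζ => ?_
    -- Any lift `ξ` of `ζ` lies in `linDist` upstairs, extends there to a global field by constant
    -- rank, and is therefore killed by the derivative of `𝔭`.
    obtain ⟨ξ, rfl⟩ := hmd y ζ
    obtain ⟨X, hX, hXD, hXy⟩ :=
      PDHam.exists_isSmoothField_linDist hα hΩ.1 hr y ξ ((hlin y ξ).2 hζ)
    rw [← hXy]
    exact hfield X hX hXD y
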